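/- Let $f=\frac1n\sum_{i=1}^n f_i$ on $\mathbb{R}^d$, where each $f_i$ is convex and $L$-smooth and depends only on the coordinates in a set $T_i\subseteq[d]$, and every coordinate lies in some $T_i$. Assume the quadratic growth $f(x)-f(x^\star)\ge\frac{\mu}{2}\|x-x^\star\|^2$ for all $x$, with $\mu>0$ (as holds if $f$ is $\mu$-strongly convex with minimizer $x^\star$). Put $\kappa=L/\mu$, $\Delta=\frac1n\max_v|\{i: v\in T_i\}|$, let $P_i$ be the coordinate projection onto $T_i$, and $D=(\frac1n\sum_i P_i)^{-1}$. Consider the asynchronous lock-free method with parameters $m,\vartheta,\varphi,\eta,S,R$, started at $x_0$. Round $r=0,\dots,R-1$ starts with $\tilde x_0=z=x_r$ and consists of $S$ epochs. Epoch $s$ computes $\nabla f(\tilde x_s)$ and performs $m$ iterations, numbered $k=0,\dots,m-1$ in the order in which their reads of the shared memory $z$ are completed. Iteration $k$ draws $i_k$ uniformly from $[n]$, reads $\hat z_k$, forms $\hat y_k=\vartheta\hat z_k+(1-\vartheta)\tilde x_s-\varphi D\nabla f(\tilde x_s)$ and $\mathcal G_k=\nabla f_{i_k}(\hat y_k)-\nabla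 f_{i_k}(\tilde x_s)+P_{i_k}D\nabla f(\tilde x_s)$, and adds $-\eta\mathcal G_k$ to $z$ coordinate by coordinate with atomic writes; so $[\hat z_k]_v=[z_0]_v-\eta\sum_j[\mathcal G_j]_v$, the sum running over those $j<k$ whose coordinate $v$ was written before it was read by iteration $k$, where $z_0$ is the content of $z$ at the start of the epoch, and at the end of the epoch $z=z_0-\eta\sum_{k<m}\mathcal G_k$. Then $\tilde x_{s+1}=\hat y_t$ with $t$ uniform on $\{0,\dots,m-1\}$ and independent of the epoch, and the next epoch continues with the current $z$. Finally $x_{r+1}=\frac1S\sum_{s=0}^{S-1}\tilde x_{s+1}$. Assume (unbiasedness) that $i_k$ is independent of $\hat z_k$, jointly with $\tilde x_s$ and with $(i_j,\hat z_j)_{j<k}$, and (bounded overlaps) that the writes of iteration $j$ are completed before iteration $k$ reads whenever $k>j+\tau$. Let $\omega>1$ and $0<c_1\le c_2$. There is a constant $C$ depending only on $\omega,c_1,c_2$ such that the following holds for every such problem, every $\tilde\tau\ge\tau$, every $m$ with $c_1n\le m\le c_2n$, and every $\epsilon>0$. With $$\vartheta=\frac{\sqrt m}{\sqrt{\kappa(1+2\sqrt\Delta\tilde\tau)}+\sqrt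 m},\quad \varphi=\frac{1-\vartheta}{L},\quad \eta=\frac{1-\vartheta}{L\vartheta(1+2\sqrt\Delta\tilde\tau)},\quad S=\left\lceil2\omega\sqrt{\tfrac{\kappa}{m}(1+2\sqrt\Delta\tilde\tau)}\right\rceil$$ and a suitable number of rounds $R\le C\max\{1,\log\frac{f(x_0)-f(x^\star)}{\epsilon}\}$, the output satisfies $\mathbb E f(x_R)-f(x^\star)\le\epsilon$, and the total number of incremental gradients $\nabla f_i$ that are computed is at most $$C\max\left\{n,\sqrt{\kappa n(1+2\sqrt\Delta\tilde\tau)}\right\}\max\left\{1,\log\frac{f(x_0)-f(x^\star)}{\epsilon}\right\}$$ (where $\log 0$ is read as $0$ if $f(x_0)=f(x^\star)$). -/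

import Mathlib

open MeasureTheory ProbabilityTheory

noncomputable section

namespace AsyncSVRG

/-- The space `ℝ^d` with the Euclidean norm. -/
abbrev Vec (d : ℕ) : Type := EuclideanSpace ℝ (Fin d)

/-- The data of a finite-sum problem: the components `f_1, …, f_n` and, for each of them, the set
`T_i` of coordinates on which it is supported. -/
structure Problem (n d : ℕ) where
  f : Fin n → Vec d → ℝ
  T : Fin n → Finset (Fin d)

namespace Problem

variable {n d : ℕ}

/-- The objective `f = (1/n) ∑ f_i`. -/
def obj (p : Problem n d) (x : Vec d) : ℝ := (1 / (n : ℝ)) * ∑ i, p.f i x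

/-- The number of components whose support contains the coordinate `v`. -/
def count (p : Problem n d) (v : Fin d) : ℕ := (Finset.univ.filter fun i => v ∈ p.T i).card

/-- The sparsity measure `Δ = (1/n) max_v |{i : v ∈ T_i}|`. -/
def density (p : Problem n d) : ℝ := ((Finset.univ.sup p.count : ℕ) : ℝ) / n

/-- Each `f_i` is convex and `L`-smooth (it has an `L`-Lipschitz gradient) and depends only on the
coordinates in `T_i`; every coordinate lies in some `T_i`. -/
structure IsSparseSmoothConvex (p : Problem n d) (L : ℝ) : Prop where
  convex : ∀ i, ConvexOn ℝ Set.univ (p.f i)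
  differentiable : ∀ i, Differentiable ℝ (p.f i)
  smooth : ∀ i x y, ‖gradient (p.f i) x - gradient (p.f i) y‖ ≤ L * ‖x - y‖
  supported : ∀ i x y, (∀ v ∈ p.T i, x v = y v) → p.f i x = p.f i y
  covered : ∀ v, ∃ i, v ∈ p.T i

/-- Quadratic growth with modulus `μ` at `xs`. For `μ > 0` it makes `xs` the unique minimizer of the
objective, and it follows from `μ`-strong convexity when `xs` is the minimizer. -/
def QuadraticGrowth (p : Problem n d) (μ : ℝ) (xs : Vec d) : Prop :=
  ∀ x, μ / 2 * ‖x - xs‖ ^ 2 ≤ p.obj x - p.obj xs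

/-- Multiplication by the diagonal matrix `D = ((1/n) ∑ P_i)⁻¹`, where `P_i` is the coordinate
projection onto `T_i`: the diagonal entries of `D` are the numbers `((1/n) |{i : v ∈ T_i}|)⁻¹`. -/
def scaleD (p : Problem n d) (g : Vec d) : Vec d :=
  WithLp.toLp 2 fun v => ((1 / (n : ℝ)) * p.count v)⁻¹ * g v

/-- The coordinate projection `P_i` onto `T_i`. -/
def proj (p : Problem n d) (i : Fin n) (g : Vec d) : Vec d :=
  WithLp.toLp 2 fun v => if v ∈ p.T i then g v else 0

/-- The sparse variance-reduced estimator `𝒢_y = ∇f_i(y) - ∇f_i(x̃) + D_i ∇f(x̃)`, `D_i = P_i D`,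
for the sample `i` and the snapshot `xt = x̃`. -/
def estimator (p : Problem n d) (xt : Vec d) (i : Fin n) (y : Vec d) : Vec d :=
  gradient (p.f i) y - gradient (p.f i) xt + p.proj i (p.scaleD (gradient p.obj xt))

end Problem

/-- The scalar parameters of the method, apart from the epoch length `m`: `ϑ`, `φ`, the step
size `η`, and the number `S` of epochs in a round. -/
structure Params where
  θ : ℝ
  φ : ℝ
  η : ℝ
  S : ℕ

/-- The parameters for smoothness `L`, condition ratio `κ`, epoch length `m`, restart constant `ω`,
and asynchrony factor `a` (which is `1 + 2 √Δ τ̃`). -/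
def Params.choice (L κ a ω : ℝ) (m : ℕ) : Params where
  θ := √m / (√(κ * a) + √m)
  φ := (1 - √m / (√(κ * a) + √m)) / L
  η := (1 - √m / (√(κ * a) + √m)) / (L * (√m / (√(κ * a) + √m)) * a)
  S := ⌈2 * ω * √(κ / m * a)⌉₊

section Epoch

variable {n d : ℕ} (p : Problem n d) (par : Params)

/-- The coupling `ŷ = ϑ ẑ + (1 - ϑ) x̃ - φ D ∇f(x̃)`. -/
def couple (xt zh : Vec d) : Vec d :=
  par.θ • zh + (1 - par.θ) • xt - par.φ • p.scaleD (gradient p.obj xt)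

/-- The inconsistent read `ẑ_k` in an epoch with snapshot `xt`, initial memory content `z0` and
samples `i_0, i_1, …`; `w k j v` tells whether coordinate `v` of update `j` had been written when
iteration `k` read it:
`[ẑ_k]_v = [z_0]_v - η ∑ [𝒢_{ŷ_j}]_v`, over those `j < k` whose coordinate `v` was written. -/
def readZ (xt z0 : Vec d) (i : ℕ → Fin n) (w : ℕ → ℕ → Fin d → Bool) (k : ℕ) : Vec d :=
  WithLp.toLp 2 fun v => z0 v - par.η * ∑ j : Fin k,
    if w k j v then p.estimator xt (i j) (couple p par xt (readZ xt z0 i w j)) v else 0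
termination_by k
decreasing_by exact j.isLt

/-- The point `ŷ_k` at which iteration `k` of the epoch evaluates its gradient estimator. -/
def readY (xt z0 : Vec d) (i : ℕ → Fin n) (w : ℕ → ℕ → Fin d → Bool) (k : ℕ) : Vec d :=
  couple p par xt (readZ p par xt z0 i w k)

/-- The virtual iterates `z_{k+1} = z_k - η 𝒢_{ŷ_k}`. The last one, `z_m`, is the content of the
shared memory once all the `m` updates of the epoch have been written. -/
def virtualZ (xt z0 : Vec d) (i : ℕ → Fin n) (w : ℕ → ℕ → Fin d → Bool) : ℕ → Vec d
  | 0 => z0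
  | k + 1 => virtualZ xt z0 i w k -
      par.η • p.estimator xt (i k) (readY p par xt z0 i w k)

end Epoch

/-- The state of the method between two epochs: the snapshot `x̃_s`, the content `z` of the shared
memory, and the number of incremental gradients (of the `f_i`) computed so far. -/
structure State (d : ℕ) where
  snapshot : Vec d
  memory : Vec d
  calls : ℕ

/-- The random quantities of an execution with epochs of length `m`; `r` numbers the rounds
(restarts), `s` the epochs in a round, and `k`, `j` the iterations in an epoch, in the order in which
their reads of the shared memory are completed.
`sample r s k` is the index `i_k`; `written r s k j v` says whether the write of coordinate `v` by
iteration `j` preceded its read by iteration `k`; `pick r s` is the index `t` of the next snapshot. -/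
structure Execution (Ω : Type*) [MeasurableSpace Ω] (n d m : ℕ) where
  sample : ℕ → ℕ → ℕ → Ω → Fin n
  written : ℕ → ℕ → ℕ → ℕ → Fin d → Ω → Bool
  pick : ℕ → ℕ → Ω → Fin m
  measurable_sample : ∀ r s k, Measurable (sample r s k)
  measurable_written : ∀ r s k j v, Measurable (written r s k j v)
  measurable_pick : ∀ r s, Measurable (pick r s)

namespace Execution

variable {Ω : Type*} [MeasurableSpace Ω] {n d m : ℕ}

/-- The state after `s` epochs of round `r`, when the round starts at `x` with `c` incremental
gradients already computed. An epoch computes the full gradient `∇f(x̃_s)` (`n` incremental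
gradients) and then performs `m` iterations, each with the two incremental gradients
`∇f_{i_k}(ŷ_k)` and `∇f_{i_k}(x̃_s)`. -/
def epochs (e : Execution Ω n d m) (p : Problem n d) (par : Params) (o : Ω) (r : ℕ)
    (x : Vec d) (c : ℕ) : ℕ → State d
  | 0 => ⟨x, x, c⟩
  | s + 1 =>
    let st := e.epochs p par o r x c s
    let i : ℕ → Fin n := fun k => e.sample r s k o
    let w : ℕ → ℕ → Fin d → Bool := fun k j v => e.written r s k j v o
    { snapshot := readY p par st.snapshot st.memory i w (e.pick r s o)
      memory := virtualZ p par st.snapshot st.memory i w m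
      calls := st.calls + n + 2 * m }

/-- The restart point `x_r` after `r` rounds, with the number of incremental gradients computed up
to then; `x_{r+1} = (1/S) ∑_{s < S} x̃_{s+1}`. -/
def rounds (e : Execution Ω n d m) (p : Problem n d) (par : Params) (x₀ : Vec d) (o : Ω) :
    ℕ → Vec d × ℕ
  | 0 => (x₀, 0)
  | r + 1 =>
    let q := e.rounds p par x₀ o r
    ((1 / (par.S : ℝ)) • ∑ s ∈ Finset.range par.S, (e.epochs p par o r q.1 q.2 (s + 1)).snapshot,
      (e.epochs p par o r q.1 q.2 par.S).calls)

/-- The output `x_R` of the method with `R` rounds. -/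
def output (e : Execution Ω n d m) (p : Problem n d) (par : Params) (x₀ : Vec d) (R : ℕ)
    (o : Ω) : Vec d := (e.rounds p par x₀ o R).1

/-- The number of incremental gradients computed in `R` rounds. -/
def oracleCalls (e : Execution Ω n d m) (p : Problem n d) (par : Params) (x₀ : Vec d) (R : ℕ)
    (o : Ω) : ℕ := (e.rounds p par x₀ o R).2

/-- The state at the beginning of epoch `s` of round `r`. -/
def stateAt (e : Execution Ω n d m) (p : Problem n d) (par : Params) (x₀ : Vec d) (r s : ℕ)
    (o : Ω) : State d :=
  e.epochs p par o r (e.rounds p par x₀ o r).1 (e.rounds p par x₀ o r).2 s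

/-- The inconsistent read `ẑ_k` in epoch `s` of round `r`. -/
def zhat (e : Execution Ω n d m) (p : Problem n d) (par : Params) (x₀ : Vec d) (r s k : ℕ)
    (o : Ω) : Vec d :=
  readZ p par (e.stateAt p par x₀ r s o).snapshot (e.stateAt p par x₀ r s o).memory
    (fun j => e.sample r s j o) (fun k' j v => e.written r s k' j v o) k

/-- What has happened in epoch `s` of round `r` before iteration `k`: the snapshot `x̃_s` and
`i_j`, `ẑ_j` for `j < k`. The memory content at the start of the epoch is `ẑ_0`. -/
def history (e : Execution Ω n d m) (p : Problem n d) (par : Params) (x₀ : Vec d) (r s k : ℕ)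
    (o : Ω) : Vec d × (Fin k → Fin n × Vec d) :=
  ((e.stateAt p par x₀ r s o).snapshot,
    fun j => (e.sample r s j o, e.zhat p par x₀ r s j o))

/-- The random choices of the method in its first `R` rounds. The samples `i_k` are uniform on `[n]`,
and `i_k` is independent of the inconsistent read `ẑ_k` jointly with the history of the epoch before
iteration `k` (unbiasedness). The snapshot index is uniform on `{0, …, m - 1}` and independent of the
epoch from which it picks the next snapshot. -/
structure Unbiased (e : Execution Ω n d m) (P : Measure Ω) (p : Problem n d) (par : Params)
    (x₀ : Vec d) (R : ℕ) : Prop where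
  sample_uniform : ∀ r < R, ∀ s < par.S, ∀ k < m, ∀ a : Fin n,
    P.real {o | e.sample r s k o = a} = 1 / n
  sample_indep : ∀ r < R, ∀ s < par.S, ∀ k < m,
    IndepFun (e.sample r s k)
      (fun o => (e.history p par x₀ r s k o, e.zhat p par x₀ r s k o)) P
  pick_uniform : ∀ r < R, ∀ s < par.S, ∀ a : Fin m, P.real {o | e.pick r s o = a} = 1 / m
  pick_indep : ∀ r < R, ∀ s < par.S,
    IndepFun (e.pick r s) (e.history p par x₀ r s m) P

/-- At most `τ` iterations overlap: everything written by iteration `j` is in the shared memory when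
an iteration `k > j + τ` reads it. -/
def BoundedOverlap (e : Execution Ω n d m) (par : Params) (R τ : ℕ) : Prop :=
  ∀ r < R, ∀ s < par.S, ∀ k < m, ∀ j, j + τ < k → ∀ v o, e.written r s k j v o = true

end Execution

end AsyncSVRG

end

/-! The proof is a linear-coupling argument for variance reduction, with the asynchrony paid for by
the step size. Write `a = 1 + 2√Δ τ̃`, and compare the reads `ẑ_k` with the virtual iterates `z_k`
obtained by applying all earlier updates.

One step (`couple_obj_sub_le`): convexity at `ŷ_k` bounds its suboptimality by inner products with
`∇f(ŷ_k)`. Cocoercivity of the `∇f_i` and the identity `(1/n) ∑ P_i D = 1` bound the second moment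
of the estimator by a Bregman term plus `2⟨∇f(ŷ_k), D∇f(x̃)⟩`; the shift `-φ D∇f(x̃)` in the
coupling is there to cancel that last term. What remains is `θ⟨∇f(ŷ_k), ẑ_k - x*⟩` together with a
gain of `θηa/2` times the second moment.

Asynchrony (`integral_inner_direction_le`): the part of the inner product along `z_k - x*`
telescopes at the cost of `η/2` second moments. The part along `ẑ_k - z_k` involves only overlapping
updates, restricted to the support of the current sample. That sample is independent of the earlier
directions, so each overlap costs a factor `√Δ`. With at most `τ` overlaps per iteration the total
cost is `η(1 + 2√Δ τ)/2 ≤ ηa/2` per second moment, which the gain absorbs.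

Hence `F_{s+1} ≤ (1-θ)F_s + c(Z_s - Z_{s+1})` across an epoch (`epoch_progress`), where `F` is the
expected gap, `Z` the expected squared distance of the memory from `x*`, and `c = θ/(2ηm)`.
Summation over a round, Jensen and quadratic growth contract the gap by `1/ω` (`round_contraction`).
Logarithmically many rounds then suffice, each costing `S(n + 2m)` gradients.

All random quantities are functions of finitely many finite-valued variables. `SimpleMap` records
this and settles measurability and integrability throughout. -/

noncomputable section

/-! ### Maps with finite range and measurable fibres -/

/-- A map on a measurable space that takes finitely many values, each on a measurable set. No
measurable structure on the codomain is involved. -/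
structure SimpleMap {Ω α : Type*} [MeasurableSpace Ω] (g : Ω → α) : Prop where
  finite_range : (Set.range g).Finite
  measurableSet_preimage : ∀ s : Set α, MeasurableSet (g ⁻¹' s)

namespace SimpleMap

variable {Ω α β : Type*} [MeasurableSpace Ω]

theorem const (a : α) : SimpleMap fun _ : Ω => a :=
  ⟨Set.finite_range_const, fun _ => MeasurableSet.const _⟩

theorem comp {g : Ω → α} (hg : SimpleMap g) (F : α → β) : SimpleMap fun o => F (g o) :=
  ⟨by
    rw [show (fun o => F (g o)) = F ∘ g from rfl, Set.range_comp]
    exact hg.finite_range.image F,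
   fun s => hg.measurableSet_preimage (F ⁻¹' s)⟩

theorem pi {ι : Type*} [Finite ι] {γ : ι → Type*} {g : ∀ i, Ω → γ i}
    (hg : ∀ i, SimpleMap (g i)) : SimpleMap fun o i => g i o := by
  have hfin : (Set.range fun o i => g i o).Finite := by
    refine (Set.Finite.pi fun i => (hg i).finite_range).subset ?_
    rintro _ ⟨o, rfl⟩ i -
    exact ⟨o, rfl⟩
  refine ⟨hfin, fun s => ?_⟩
  have : (fun o i => g i o) ⁻¹' s =
      ⋃ f ∈ (Set.range fun o i => g i o) ∩ s, ⋂ i, g i ⁻¹' {f i} := by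
    ext o
    simp only [Set.mem_preimage, Set.mem_iUnion, Set.mem_iInter, Set.mem_singleton_iff,
      exists_prop]
    constructor
    · exact fun h => ⟨_, ⟨⟨o, rfl⟩, h⟩, fun i => rfl⟩
    · rintro ⟨f, ⟨-, hf⟩, h⟩
      rwa [show (fun i => g i o) = f from funext h]
  rw [this]
  exact MeasurableSet.biUnion (hfin.inter_of_left s).countable
    fun f _ => MeasurableSet.iInter fun i => (hg i).measurableSet_preimage _

theorem comp₂ {γ : Type*} {g : Ω → α} {h : Ω → β} (hg : SimpleMap g) (hh : SimpleMap h)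
    (F : α → β → γ) : SimpleMap fun o => F (g o) (h o) := by
  have hfin : (Set.range fun o => (g o, h o)).Finite := by
    refine (hg.finite_range.prod hh.finite_range).subset ?_
    rintro _ ⟨o, rfl⟩
    exact ⟨⟨o, rfl⟩, ⟨o, rfl⟩⟩
  refine comp (g := fun o => (g o, h o)) ⟨hfin, fun s => ?_⟩ fun x => F x.1 x.2
  have : (fun o => (g o, h o)) ⁻¹' s =
      ⋃ f ∈ (Set.range fun o => (g o, h o)) ∩ s, g ⁻¹' {f.1} ∩ h ⁻¹' {f.2} := by
    ext o
    simp only [Set.mem_preimage, Set.mem_iUnion, Set.mem_inter_iff, Set.mem_singleton_iff,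
      exists_prop]
    constructor
    · exact fun h => ⟨_, ⟨⟨o, rfl⟩, h⟩, rfl, rfl⟩
    · rintro ⟨f, ⟨-, hf⟩, h1, h2⟩
      rwa [h1, h2]
  rw [this]
  exact MeasurableSet.biUnion (hfin.inter_of_left s).countable
    fun f _ => (hg.measurableSet_preimage _).inter (hh.measurableSet_preimage _)

theorem of_measurable [Finite α] [MeasurableSpace α] [MeasurableSingletonClass α] {g : Ω → α}
    (hg : Measurable g) : SimpleMap g :=
  ⟨Set.toFinite _, fun s => hg s.toFinite.measurableSet⟩

theorem measurable [MeasurableSpace α] {g : Ω → α} (hg : SimpleMap g) : Measurable g :=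
  fun s _ => hg.measurableSet_preimage s

theorem sum {ι M : Type*} [AddCommMonoid M] (s : Finset ι) {g : ι → Ω → M}
    (hg : ∀ i, SimpleMap (g i)) : SimpleMap fun o => ∑ i ∈ s, g i o := by
  have := (pi fun i : s => hg i).comp fun f => ∑ i, f i
  exact (funext fun o => Finset.sum_coe_sort s fun i => g i o) ▸ this

theorem integrable {P : Measure Ω} [IsFiniteMeasure P] {g : Ω → ℝ} (hg : SimpleMap g) :
    Integrable g P := by
  obtain ⟨C, hC⟩ := (hg.finite_range.image fun x : ℝ => ‖x‖).bddAbove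
  exact Integrable.of_bound hg.measurable.aestronglyMeasurable C
    (.of_forall fun o => hC ⟨_, ⟨o, rfl⟩, rfl⟩)

/-- Independence of a map with finite range passes to its image under an arbitrary function. -/
theorem indepFun_comp {γ : Type*} [MeasurableSpace α] [MeasurableSpace β]
    [MeasurableSingletonClass β] [MeasurableSpace γ] {P : Measure Ω} {X : Ω → α} {H : Ω → β}
    (hH : SimpleMap H) (h : IndepFun X H P) (F : β → γ) : IndepFun X (fun o => F (H o)) P := by
  rw [indepFun_iff_measure_inter_preimage_eq_mul] at h ⊢
  intro s t hs _
  -- Only the finite set of attained values matters, and it is measurable, so `F` need not be.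
  have : (fun o => F (H o)) ⁻¹' t = H ⁻¹' (Set.range H ∩ F ⁻¹' t) := by
    ext o
    simp
  rw [this]
  exact h s _ hs (hH.finite_range.inter_of_left _).measurableSet

/-- Integrating out a uniformly distributed variable that is independent of a map with finite
range. -/
theorem integral_uniform [Fintype α] [MeasurableSpace α] [MeasurableSingletonClass α]
    [MeasurableSpace β] [MeasurableSingletonClass β] {P : Measure Ω} [IsProbabilityMeasure P]
    {X : Ω → α} {H : Ω → β} (hX : Measurable X) (hH : SimpleMap H) (h : IndepFun X H P) {q : ℝ}
    (hq : ∀ a, P.real {o | X o = a} = q) (ψ : α → β → ℝ) :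
    ∫ o, ψ (X o) (H o) ∂P = ∫ o, q * ∑ a, ψ a (H o) ∂P := by
  classical
  have hXs := of_measurable hX
  have key : ∀ a, ∫ o, (if X o = a then (1 : ℝ) else 0) * ψ a (H o) ∂P =
      q * ∫ o, ψ a (H o) ∂P := by
    intro a
    have h1 : IndepFun (fun o => if X o = a then (1 : ℝ) else 0) (fun o => ψ a (H o)) P :=
      (hH.indepFun_comp h (ψ a)).comp (φ := fun x => if x = a then (1 : ℝ) else 0)
        (ψ := id) (measurable_of_finite _) measurable_id
    rw [h1.integral_fun_mul_eq_mul_integral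
      (hXs.comp fun x => if x = a then (1 : ℝ) else 0).measurable.aestronglyMeasurable
      (hH.comp (ψ a)).measurable.aestronglyMeasurable]
    congr 1
    rw [← hq a, show {o | X o = a} = X ⁻¹' {a} from rfl,
      ← integral_indicator_one (hX (measurableSet_singleton a))]
    refine integral_congr_ae (.of_forall fun o => ?_)
    simp [Set.indicator]
  calc ∫ o, ψ (X o) (H o) ∂P
      = ∫ o, ∑ a, (if X o = a then (1 : ℝ) else 0) * ψ a (H o) ∂P := by
        simp
    _ = ∑ a, q * ∫ o, ψ a (H o) ∂P := by
        rw [integral_finsetSum _ fun a _ => (hXs.comp₂ hH fun x b =>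
          (if x = a then (1 : ℝ) else 0) * ψ a b).integrable]
        exact Finset.sum_congr rfl fun a _ => key a
    _ = _ := by
        rw [integral_const_mul, integral_finsetSum _ fun a _ => (hH.comp (ψ a)).integrable,
          Finset.mul_sum]

end SimpleMap

/-! ### Smooth convex functions -/

section SmoothConvex

variable {E : Type*} [NormedAddCommGroup E] [InnerProductSpace ℝ E] [CompleteSpace E]

theorem hasDerivAt_comp_line {f : E → ℝ} (hf : Differentiable ℝ f) (x v : E) (t : ℝ) :
    HasDerivAt (fun t : ℝ => f (x + t • v)) (inner ℝ (gradient f (x + t • v)) v) t := by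
  have h1 : HasDerivAt (fun t : ℝ => x + t • v) v t := by
    simpa using ((hasDerivAt_id t).smul_const v).const_add x
  have h2 := (hf (x + t • v)).hasFDerivAt.comp_hasDerivAt t h1
  rwa [← inner_gradient_left] at h2

theorem ConvexOn.add_inner_gradient_le {f : E → ℝ} (hc : ConvexOn ℝ Set.univ f)
    (hf : Differentiable ℝ f) (x y : E) : f y + inner ℝ (gradient f y) (x - y) ≤ f x := by
  have hφ : ConvexOn ℝ Set.univ fun t : ℝ => f (y + t • (x - y)) := by
    have := hc.comp_affineMap (AffineMap.lineMap y x)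
    simpa [Function.comp_def, AffineMap.lineMap_apply, add_comm] using this
  have h := hφ.le_slope_of_hasDerivAt (Set.mem_univ 0) (Set.mem_univ 1) zero_lt_one
    (hasDerivAt_comp_line hf y (x - y) 0)
  simp [slope_def_field, -inner_gradient_left] at h
  linarith

theorem le_add_inner_gradient_add_sq {f : E → ℝ} (hf : Differentiable ℝ f) {L : ℝ}
    (hL : ∀ x y, ‖gradient f x - gradient f y‖ ≤ L * ‖x - y‖) (x v : E) :
    f (x + v) ≤ f x + inner ℝ (gradient f x) v + L / 2 * ‖v‖ ^ 2 := by
  -- The excess of `f` on the segment over its quadratic majorant; the Lipschitz bound makes its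
  -- derivative nonpositive on `(0, 1)`.
  let g : ℝ → ℝ := fun t =>
    f (x + t • v) - t * inner ℝ (gradient f x) v - L / 2 * ‖v‖ ^ 2 * t ^ 2
  have hg : ∀ t, HasDerivAt g (inner ℝ (gradient f (x + t • v)) v - inner ℝ (gradient f x) v
      - L / 2 * ‖v‖ ^ 2 * (2 * t)) t := by
    intro t
    have h1 := (hasDerivAt_id t).mul_const (inner ℝ (gradient f x) v)
    have h2 := (hasDerivAt_pow 2 t).const_mul (L / 2 * ‖v‖ ^ 2)
    simpa [-inner_gradient_left] using ((hasDerivAt_comp_line hf x v t).fun_sub h1).fun_sub h2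
  have hanti : AntitoneOn g (Set.Icc 0 1) := by
    refine antitoneOn_of_deriv_nonpos (convex_Icc 0 1)
      (fun t _ => (hg t).continuousAt.continuousWithinAt)
      (fun t _ => (hg t).differentiableAt.differentiableWithinAt) fun t ht => ?_
    rw [interior_Icc] at ht
    rw [(hg t).deriv, ← inner_sub_left]
    have h1 := real_inner_le_norm (gradient f (x + t • v) - gradient f x) v
    have h2 := hL (x + t • v) x
    rw [add_sub_cancel_left, norm_smul, Real.norm_of_nonneg ht.1.le] at h2
    nlinarith [mul_le_mul_of_nonneg_right h2 (norm_nonneg v)]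
  have := hanti (Set.left_mem_Icc.2 zero_le_one) (Set.right_mem_Icc.2 zero_le_one) zero_le_one
  simp only [g, one_smul, zero_smul, add_zero, one_mul, zero_mul, one_pow, mul_one, ne_eq,
    OfNat.ofNat_ne_zero, not_false_eq_true, zero_pow, mul_zero, sub_zero] at this
  linarith

/-- Cocoercivity of the gradient of a convex function with Lipschitz gradient. -/
theorem ConvexOn.norm_gradient_sub_sq_le {f : E → ℝ} (hc : ConvexOn ℝ Set.univ f)
    (hf : Differentiable ℝ f) {L : ℝ} (hL0 : 0 < L)
    (hL : ∀ x y, ‖gradient f x - gradient f y‖ ≤ L * ‖x - y‖) (x y : E) :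
    ‖gradient f y - gradient f x‖ ^ 2 ≤
      2 * L * (f x - f y - inner ℝ (gradient f y) (x - y)) := by
  set u := gradient f x - gradient f y with hu
  -- The point `x - u/L` is bounded above by smoothness at `x` and below by convexity at `y`; the
  -- step `1/L` minimizes the quadratic in the comparison.
  have h1 := le_add_inner_gradient_add_sq hf hL x (-(1 / L) • u)
  have h2 := hc.add_inner_gradient_le hf (x + -(1 / L) • u) y
  rw [show x + -(1 / L) • u - y = (x - y) + -(1 / L) • u by abel, inner_add_right] at h2
  simp only [inner_smul_right, norm_smul, norm_neg, mul_pow] at h1 h2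
  have h3 : inner ℝ (gradient f x) u - inner ℝ (gradient f y) u = ‖u‖ ^ 2 := by
    rw [← inner_sub_left, ← hu, real_inner_self_eq_norm_sq]
  rw [Real.norm_of_nonneg (by positivity)] at h1
  have h4 : L / 2 * ((1 / L) ^ 2 * ‖u‖ ^ 2) = 1 / (2 * L) * ‖u‖ ^ 2 := by
    field_simp
  rw [h4] at h1
  have h5 : 1 / (2 * L) * ‖u‖ ^ 2 ≤ f x - f y - inner ℝ (gradient f y) (x - y) := by
    have : 1 / L * ‖u‖ ^ 2 = 2 * (1 / (2 * L) * ‖u‖ ^ 2) := by field_simp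
    rw [← h3] at this h1 ⊢
    linarith
  rw [norm_sub_rev, ← hu]
  calc ‖u‖ ^ 2 = 2 * L * (1 / (2 * L) * ‖u‖ ^ 2) := by field_simp
    _ ≤ _ := by gcongr

end SmoothConvex

/-! ### The sparse variance-reduced estimator: mean, support and second moment -/

namespace AsyncSVRG

theorem inner_eq_sum {d : ℕ} (x y : Vec d) : inner ℝ x y = ∑ v, x v * y v := by
  simp [PiLp.inner_apply, mul_comm]

namespace Problem

variable {n d : ℕ} (p : Problem n d)

theorem count_div_le_density (v : Fin d) : 1 / (n : ℝ) * p.count v ≤ p.density := by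
  rw [density, one_div_mul_eq_div]
  gcongr
  exact Finset.le_sup (Finset.mem_univ v)

theorem density_nonneg : 0 ≤ p.density := by
  unfold density
  positivity

theorem proj_apply (i : Fin n) (g : Vec d) (v : Fin d) :
    p.proj i g v = if v ∈ p.T i then g v else 0 := rfl

theorem sum_proj_apply (g : Vec d) (v : Fin d) :
    ∑ i, p.proj i g v = p.count v * g v := by
  simp_rw [proj_apply]
  rw [← Finset.sum_filter, Finset.sum_const, nsmul_eq_mul]
  rfl

theorem norm_proj_sq (i : Fin n) (g : Vec d) : ‖p.proj i g‖ ^ 2 = inner ℝ (p.proj i g) g := by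
  rw [EuclideanSpace.real_norm_sq_eq, inner_eq_sum]
  refine Finset.sum_congr rfl fun v _ => ?_
  rw [proj_apply]
  split_ifs <;> ring

/-- A coordinate survives only a fraction at most `Δ` of the projections. This is how sparsity
enters the bound on overlaps. -/
theorem sum_norm_proj_sq_le (g : Vec d) :
    1 / (n : ℝ) * ∑ i, ‖p.proj i g‖ ^ 2 ≤ p.density * ‖g‖ ^ 2 := by
  simp_rw [norm_proj_sq, inner_eq_sum]
  rw [Finset.sum_comm, EuclideanSpace.real_norm_sq_eq, Finset.mul_sum, Finset.mul_sum]
  refine Finset.sum_le_sum fun v _ => ?_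
  rw [← Finset.sum_mul, sum_proj_apply]
  nlinarith [p.count_div_le_density v, sq_nonneg (g v)]

theorem inner_scaleD_nonneg (g : Vec d) : 0 ≤ inner ℝ g (p.scaleD g) := by
  rw [inner_eq_sum]
  refine Finset.sum_nonneg fun v _ => ?_
  simp only [scaleD]
  rw [mul_left_comm]
  exact mul_nonneg (by positivity) (mul_self_nonneg _)

namespace IsSparseSmoothConvex

variable {p} {L : ℝ} (h : p.IsSparseSmoothConvex L)
include h

theorem count_pos (v : Fin d) : 0 < p.count v := by
  obtain ⟨i, hi⟩ := h.covered v
  exact Finset.card_pos.2 ⟨i, by simpa using hi⟩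

/-- A coordinate `v` has to be supplied because `Δ = 0` in dimension zero. -/
theorem density_pos (hn : 0 < n) (v : Fin d) : 0 < p.density := by
  refine lt_of_lt_of_le ?_ (p.count_div_le_density v)
  have := h.count_pos v
  positivity

theorem gradient_apply_eq_zero (i : Fin n) (x : Vec d) {v : Fin d} (hv : v ∉ p.T i) :
    gradient (p.f i) x v = 0 := by
  have h1 := hasDerivAt_comp_line (h.differentiable i) x (EuclideanSpace.single v 1) 0
  have h2 : (fun t : ℝ => p.f i (x + t • EuclideanSpace.single v 1)) = fun _ => p.f i x := by
    funext t
    refine h.supported i _ _ fun u hu => ?_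
    have : u ≠ v := fun e => hv (e ▸ hu)
    simp [this]
  rw [h2] at h1
  have := h1.unique (hasDerivAt_const _ _)
  simpa [inner_eq_sum, -inner_gradient_left, Pi.single_apply] using this

theorem hasGradientAt_obj (x : Vec d) :
    HasGradientAt p.obj ((1 / (n : ℝ)) • ∑ i, gradient (p.f i) x) x := by
  rw [hasGradientAt_iff_hasFDerivAt]
  have := (HasFDerivAt.fun_sum (u := Finset.univ) fun i _ =>
    (h.differentiable i x).hasGradientAt.hasFDerivAt).const_mul (1 / (n : ℝ))
  rw [show p.obj = fun y => 1 / (n : ℝ) * ∑ i, p.f i y from rfl]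
  simpa [map_smul, map_sum] using this

theorem gradient_obj (x : Vec d) :
    gradient p.obj x = (1 / (n : ℝ)) • ∑ i, gradient (p.f i) x :=
  (h.hasGradientAt_obj x).gradient

theorem differentiable_obj : Differentiable ℝ p.obj :=
  fun x => (h.hasGradientAt_obj x).differentiableAt

theorem convexOn_obj : ConvexOn ℝ Set.univ p.obj := by
  have : ∀ s : Finset (Fin n), ConvexOn ℝ Set.univ fun x => ∑ i ∈ s, p.f i x := by
    intro s
    induction s using Finset.cons_induction with
    | empty => simpa using convexOn_const (0 : ℝ) convex_univ
    | cons a s ha ih =>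
      simp_rw [Finset.sum_cons]
      exact (h.convex a).add ih
  exact (this Finset.univ).smul (by positivity : 0 ≤ 1 / (n : ℝ))

/-- The purpose of `D`: it undoes the averaged projections, whose diagonal entries are positive
since every coordinate is covered. -/
theorem sum_proj_scaleD (hn : 0 < n) (g : Vec d) :
    (1 / (n : ℝ)) • ∑ i, p.proj i (p.scaleD g) = g := by
  ext v
  have := h.count_pos v
  simp only [PiLp.smul_apply, WithLp.ofLp_sum, Finset.sum_apply, smul_eq_mul, sum_proj_apply]
  simp only [scaleD]
  field_simp

/-- The estimator is unbiased. -/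
theorem mean_estimator (hn : 0 < n) (xt y : Vec d) :
    (1 / (n : ℝ)) • ∑ i, p.estimator xt i y = gradient p.obj y := by
  simp only [estimator, Finset.sum_add_distrib, Finset.sum_sub_distrib, smul_add, smul_sub]
  rw [h.sum_proj_scaleD hn, ← h.gradient_obj, ← h.gradient_obj]
  abel

theorem mean_inner_estimator (hn : 0 < n) (xt y u : Vec d) :
    1 / (n : ℝ) * ∑ i, inner ℝ (p.estimator xt i y) u = inner ℝ (gradient p.obj y) u := by
  rw [← sum_inner, ← real_inner_smul_left, h.mean_estimator hn]

theorem estimator_apply_eq_zero (xt y : Vec d) (i : Fin n) {v : Fin d} (hv : v ∉ p.T i) :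
    p.estimator xt i y v = 0 := by
  simp [estimator, h.gradient_apply_eq_zero i _ hv, proj_apply, hv]

/-- The second moment of the estimator. -/
theorem mean_norm_estimator_sq_le (hn : 0 < n) (hL : 0 < L) (xt y : Vec d) :
    1 / (n : ℝ) * ∑ i, ‖p.estimator xt i y‖ ^ 2 ≤
      2 * L * (p.obj xt - p.obj y - inner ℝ (gradient p.obj y) (xt - y)) +
        2 * inner ℝ (gradient p.obj y) (p.scaleD (gradient p.obj xt)) := by
  set g := gradient p.obj xt
  set u := p.scaleD g
  -- Gradient differences of `f_i` live on `T_i`, so the projection can be dropped from the cross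
  -- term.
  have hinner : ∀ i, inner ℝ (gradient (p.f i) y - gradient (p.f i) xt) (p.proj i u) =
      inner ℝ (gradient (p.f i) y - gradient (p.f i) xt) u := by
    intro i
    rw [inner_eq_sum, inner_eq_sum]
    refine Finset.sum_congr rfl fun v _ => ?_
    rw [proj_apply]
    split_ifs with hv
    · rfl
    · simp [h.gradient_apply_eq_zero i _ hv]
  have hterm : ∀ i, ‖p.estimator xt i y‖ ^ 2 ≤
      2 * L * (p.f i xt - p.f i y - inner ℝ (gradient (p.f i) y) (xt - y)) +
        2 * inner ℝ (gradient (p.f i) y - gradient (p.f i) xt) u + inner ℝ (p.proj i u) u := by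
    intro i
    rw [estimator, norm_add_sq_real, hinner, norm_proj_sq]
    have := (h.convex i).norm_gradient_sub_sq_le (h.differentiable i) hL (h.smooth i) xt y
    linarith
  calc 1 / (n : ℝ) * ∑ i, ‖p.estimator xt i y‖ ^ 2
      ≤ 1 / (n : ℝ) * ∑ i, (2 * L * (p.f i xt - p.f i y -
        inner ℝ (gradient (p.f i) y) (xt - y)) +
        2 * inner ℝ (gradient (p.f i) y - gradient (p.f i) xt) u +
        inner ℝ (p.proj i u) u) := by
        gcongr with i
        exact hterm i
    _ = 2 * L * (p.obj xt - p.obj y - inner ℝ (gradient p.obj y) (xt - y)) +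
        2 * inner ℝ (gradient p.obj y - g) u +
        inner ℝ ((1 / (n : ℝ)) • ∑ i, p.proj i u) u := by
        simp only [g, h.gradient_obj, obj, Finset.sum_add_distrib, ← Finset.mul_sum,
          Finset.sum_sub_distrib, ← sum_inner, inner_sub_left, real_inner_smul_left]
        ring
    _ ≤ _ := by
        -- The terms in `⟨g, Dg⟩` add up to `-2 + 1 = -1` times it, and `D` is positive
        -- semidefinite.
        rw [h.sum_proj_scaleD hn, inner_sub_left]
        have := p.inner_scaleD_nonneg g
        linarith

end IsSparseSmoothConvex

end Problem

/-! ### Inconsistent reads against virtual iterates, pathwise -/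

section Epoch

variable {n d : ℕ} {p : Problem n d} {L : ℝ}

theorem virtualZ_apply (par : Params) (xt z0 : Vec d) (i : ℕ → Fin n)
    (w : ℕ → ℕ → Fin d → Bool) (k : ℕ) (v : Fin d) :
    virtualZ p par xt z0 i w k v = z0 v - par.η * ∑ j : Fin k,
      p.estimator xt (i j) (readY p par xt z0 i w j) v := by
  rw [Fin.sum_univ_eq_sum_range fun j => p.estimator xt (i j) (readY p par xt z0 i w j) v]
  induction k with
  | zero => simp [virtualZ]
  | succ k ih =>
    rw [Finset.sum_range_succ, virtualZ]
    simp only [PiLp.sub_apply, PiLp.smul_apply, smul_eq_mul, ih]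
    ring

/-- The gap between an inconsistent read and the virtual iterate is made of the overlapping
updates. -/
theorem readZ_sub_virtualZ_apply (par : Params) (xt z0 : Vec d) (i : ℕ → Fin n)
    (w : ℕ → ℕ → Fin d → Bool) (k : ℕ) (v : Fin d) :
    (readZ p par xt z0 i w k - virtualZ p par xt z0 i w k) v = par.η * ∑ j ∈ Finset.range k,
      if w k j v then 0 else p.estimator xt (i j) (readY p par xt z0 i w j) v := by
  rw [PiLp.sub_apply, virtualZ_apply, readZ]
  change z0 v - par.η * (∑ j : Fin k, if w k j v = true then
    p.estimator xt (i j) (readY p par xt z0 i w j) v else 0) - _ = _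
  rw [sub_sub_sub_cancel_left, ← mul_sub, ← Finset.sum_sub_distrib,
    ← Fin.sum_univ_eq_sum_range fun j => if w k j v = true then 0 else
      p.estimator xt (i j) (readY p par xt z0 i w j) v]
  congr 1
  refine Finset.sum_congr rfl fun j _ => ?_
  split_ifs <;> simp

/-- Overlapping updates interact only on the support of the later one. -/
theorem sum_estimator_mul_le (h : p.IsSparseSmoothConvex L) (hn : 0 < n) (xt y g : Vec d)
    (i : Fin n) (b : Fin d → Bool) :
    (∑ v, p.estimator xt i y v * if b v then 0 else g v) ≤
      (2 * √p.density)⁻¹ * ‖p.proj i g‖ ^ 2 + √p.density / 2 * ‖p.estimator xt i y‖ ^ 2 := by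
  rw [EuclideanSpace.real_norm_sq_eq, EuclideanSpace.real_norm_sq_eq, Finset.mul_sum,
    Finset.mul_sum, ← Finset.sum_add_distrib]
  refine Finset.sum_le_sum fun v _ => ?_
  have hs : 0 < √p.density := Real.sqrt_pos.2 (h.density_pos hn v)
  set s := √p.density
  have h0 : 0 ≤ (2 * s)⁻¹ * p.proj i g v ^ 2 + s / 2 * p.estimator xt i y v ^ 2 := by positivity
  by_cases hv : v ∈ p.T i
  · split_ifs with hb
    · simpa using h0
    · rw [Problem.proj_apply, if_pos hv]
      -- Weighted AM-GM. The weight `√Δ` is balanced: averaging `‖P_i g‖²` gains a factor `Δ`, after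
      -- which both squares carry the coefficient `√Δ / 2`.
      have : (2 * s)⁻¹ * g v ^ 2 + s / 2 * p.estimator xt i y v ^ 2 -
          p.estimator xt i y v * g v = (2 * s)⁻¹ * (g v - s * p.estimator xt i y v) ^ 2 := by
        field_simp
        ring
      have h1 : 0 ≤ (2 * s)⁻¹ * (g v - s * p.estimator xt i y v) ^ 2 := by positivity
      linarith
  · rw [h.estimator_apply_eq_zero xt y i hv] at h0 ⊢
    simpa using h0

theorem inner_estimator_readZ_sub_virtualZ_le (h : p.IsSparseSmoothConvex L) (hn : 0 < n)
    (par : Params) (hη : 0 ≤ par.η) (xt z0 : Vec d) (i : ℕ → Fin n)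
    (w : ℕ → ℕ → Fin d → Bool) {k τ : ℕ} (hw : ∀ j, j + τ < k → ∀ v, w k j v = true) :
    let G := fun j => p.estimator xt (i j) (readY p par xt z0 i w j)
    inner ℝ (G k) (readZ p par xt z0 i w k - virtualZ p par xt z0 i w k) ≤
      par.η * ∑ j ∈ (Finset.range k).filter (fun j => k ≤ j + τ),
        ((2 * √p.density)⁻¹ * ‖p.proj (i k) (G j)‖ ^ 2 + √p.density / 2 * ‖G k‖ ^ 2) := by
  intro G
  rw [inner_eq_sum]
  simp_rw [readZ_sub_virtualZ_apply]
  calc ∑ v, G k v * (par.η * ∑ j ∈ Finset.range k, if w k j v then 0 else G j v)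
      = par.η * ∑ j ∈ Finset.range k, ∑ v, G k v * if w k j v then 0 else G j v := by
        rw [Finset.sum_comm, Finset.mul_sum]
        refine Finset.sum_congr rfl fun v _ => ?_
        rw [← Finset.mul_sum]
        ring
    _ = par.η * ∑ j ∈ (Finset.range k).filter (fun j => k ≤ j + τ),
          ∑ v, G k v * if w k j v then 0 else G j v := by
        congr 1
        symm
        -- Updates older than `τ` iterations are fully written and drop out of the gap.
        refine Finset.sum_filter_of_ne fun j _ hj => ?_
        contrapose! hj
        simp [hw j hj]
    _ ≤ _ := by
        gcongr with j
        exact sum_estimator_mul_le h hn _ _ _ _ _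

end Epoch

/-! ### Finiteness of the range of every random quantity of an execution -/

section Simple

variable {Ω : Type*} [MeasurableSpace Ω] {n d m : ℕ} {p : Problem n d} {par : Params}
  {xt z0 : Ω → Vec d} {i : ℕ → Ω → Fin n} {w : ℕ → ℕ → Fin d → Ω → Bool}

theorem simpleMap_readZ (hx : SimpleMap xt) (hz : SimpleMap z0) (hi : ∀ k, SimpleMap (i k))
    (hw : ∀ k j v, SimpleMap (w k j v)) (k : ℕ) :
    SimpleMap fun o => readZ p par (xt o) (z0 o) (fun j => i j o) (fun k j v => w k j v o) k := by
  induction k using Nat.strong_induction_on with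
  | _ k ih =>
    have : ∀ v, SimpleMap fun o => z0 o v - par.η * ∑ j : Fin k, if w k j v o then
        p.estimator (xt o) (i j o) (couple p par (xt o)
          (readZ p par (xt o) (z0 o) (fun j => i j o) (fun k j v => w k j v o) j)) v else 0 := by
      intro v
      refine hz.comp₂ (SimpleMap.sum Finset.univ fun j : Fin k => ?_) fun z c => z v - par.η * c
      have h1 := hx.comp₂ (ih j j.isLt) fun x z => (x, couple p par x z)
      have h2 := h1.comp₂ (hi j) fun x a => p.estimator x.1 a x.2 v
      exact (hw k j v).comp₂ h2 fun b c => if b then c else 0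
    have h3 := (SimpleMap.pi this).comp (WithLp.toLp 2)
    convert h3 using 2 with o
    rw [readZ]

theorem simpleMap_readY (hx : SimpleMap xt) (hz : SimpleMap z0) (hi : ∀ k, SimpleMap (i k))
    (hw : ∀ k j v, SimpleMap (w k j v)) (k : ℕ) :
    SimpleMap fun o => readY p par (xt o) (z0 o) (fun j => i j o) (fun k j v => w k j v o) k :=
  hx.comp₂ (simpleMap_readZ hx hz hi hw k) (couple p par)

theorem simpleMap_virtualZ (hx : SimpleMap xt) (hz : SimpleMap z0) (hi : ∀ k, SimpleMap (i k))
    (hw : ∀ k j v, SimpleMap (w k j v)) (k : ℕ) :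
    SimpleMap fun o =>
      virtualZ p par (xt o) (z0 o) (fun j => i j o) (fun k j v => w k j v o) k := by
  induction k with
  | zero => exact hz
  | succ k ih =>
    have h1 := hx.comp₂ (simpleMap_readY (p := p) (par := par) hx hz hi hw k) Prod.mk
    have h2 := h1.comp₂ (hi k) fun x a => p.estimator x.1 a x.2
    exact ih.comp₂ h2 fun z g => z - par.η • g

end Simple

namespace Execution

variable {Ω : Type*} [MeasurableSpace Ω] {n d m : ℕ} (e : Execution Ω n d m) (p : Problem n d)
  (par : Params) (x₀ : Vec d)

theorem simpleMap_sample (r s k : ℕ) : SimpleMap (e.sample r s k) :=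
  .of_measurable (e.measurable_sample r s k)

theorem simpleMap_written (r s k j : ℕ) (v : Fin d) : SimpleMap (e.written r s k j v) :=
  .of_measurable (e.measurable_written r s k j v)

theorem simpleMap_epochs (r : ℕ) {q : Ω → Vec d × ℕ} (hq : SimpleMap fun o => (q o).1) (s : ℕ) :
    SimpleMap (fun o => (e.epochs p par o r (q o).1 (q o).2 s).snapshot) ∧
      SimpleMap (fun o => (e.epochs p par o r (q o).1 (q o).2 s).memory) := by
  induction s with
  | zero => exact ⟨hq, hq⟩
  | succ s ih =>
    refine ⟨?_, simpleMap_virtualZ ih.1 ih.2 (e.simpleMap_sample r s) (e.simpleMap_written r s) m⟩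
    -- The next snapshot has a random index, so all `m` candidate points are bundled first and then
    -- evaluated at the pick.
    exact (SimpleMap.pi fun k : Fin m => simpleMap_readY (p := p) (par := par) ih.1 ih.2
      (e.simpleMap_sample r s) (e.simpleMap_written r s) k).comp₂
      (.of_measurable (e.measurable_pick r s)) fun f t => f t

theorem simpleMap_rounds (r : ℕ) : SimpleMap fun o => (e.rounds p par x₀ o r).1 := by
  induction r with
  | zero => exact .const x₀
  | succ r ih =>
    exact (SimpleMap.sum (Finset.range par.S) fun s =>
      (e.simpleMap_epochs p par r ih (s + 1)).1).comp fun x => (1 / (par.S : ℝ)) • x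

theorem simpleMap_snapshot (r s : ℕ) :
    SimpleMap fun o => (e.stateAt p par x₀ r s o).snapshot :=
  (e.simpleMap_epochs p par r (e.simpleMap_rounds p par x₀ r) s).1

theorem simpleMap_memory (r s : ℕ) :
    SimpleMap fun o => (e.stateAt p par x₀ r s o).memory :=
  (e.simpleMap_epochs p par r (e.simpleMap_rounds p par x₀ r) s).2

theorem simpleMap_zhat (r s k : ℕ) : SimpleMap (e.zhat p par x₀ r s k) :=
  simpleMap_readZ (e.simpleMap_snapshot p par x₀ r s) (e.simpleMap_memory p par x₀ r s)
    (e.simpleMap_sample r s) (e.simpleMap_written r s) k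

theorem simpleMap_history (r s k : ℕ) : SimpleMap (e.history p par x₀ r s k) :=
  (e.simpleMap_snapshot p par x₀ r s).comp₂ (SimpleMap.pi fun j : Fin k =>
    (e.simpleMap_sample r s j).comp₂ (e.simpleMap_zhat p par x₀ r s j) Prod.mk) Prod.mk

/-- The point `ŷ_k` in epoch `s` of round `r`. -/
def yhat (r s k : ℕ) (o : Ω) : Vec d :=
  couple p par (e.stateAt p par x₀ r s o).snapshot (e.zhat p par x₀ r s k o)

/-- The update direction of iteration `k` in epoch `s` of round `r`. -/
def direction (r s k : ℕ) (o : Ω) : Vec d :=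
  p.estimator (e.stateAt p par x₀ r s o).snapshot (e.sample r s k o) (e.yhat p par x₀ r s k o)

/-- The virtual iterate `z_k` in epoch `s` of round `r`. -/
def zvirt (r s k : ℕ) (o : Ω) : Vec d :=
  virtualZ p par (e.stateAt p par x₀ r s o).snapshot (e.stateAt p par x₀ r s o).memory
    (fun j => e.sample r s j o) (fun k' j v => e.written r s k' j v o) k

theorem simpleMap_yhat (r s k : ℕ) : SimpleMap (e.yhat p par x₀ r s k) :=
  (e.simpleMap_snapshot p par x₀ r s).comp₂ (e.simpleMap_zhat p par x₀ r s k) (couple p par)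

theorem simpleMap_direction (r s k : ℕ) : SimpleMap (e.direction p par x₀ r s k) :=
  ((e.simpleMap_snapshot p par x₀ r s).comp₂ (e.simpleMap_yhat p par x₀ r s k)
    Prod.mk).comp₂ (e.simpleMap_sample r s k) fun x a => p.estimator x.1 a x.2

theorem simpleMap_zvirt (r s k : ℕ) : SimpleMap (e.zvirt p par x₀ r s k) :=
  simpleMap_virtualZ (e.simpleMap_snapshot p par x₀ r s) (e.simpleMap_memory p par x₀ r s)
    (e.simpleMap_sample r s) (e.simpleMap_written r s) k

theorem zvirt_succ (r s k : ℕ) (o : Ω) : e.zvirt p par x₀ r s (k + 1) o =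
    e.zvirt p par x₀ r s k o - par.η • e.direction p par x₀ r s k o := rfl

/-! ### Averaging over the samples and the snapshot index -/

section Expectation

variable {e p par x₀} {P : Measure Ω} [IsProbabilityMeasure P] {R : ℕ} {L : ℝ}

theorem Unbiased.integral_sample (hu : e.Unbiased P p par x₀ R) {r s k : ℕ} (hr : r < R)
    (hs : s < par.S) (hk : k < m)
    (ψ : Fin n → (Vec d × (Fin k → Fin n × Vec d)) × Vec d → ℝ) :
    ∫ o, ψ (e.sample r s k o) (e.history p par x₀ r s k o, e.zhat p par x₀ r s k o) ∂P =
      ∫ o, 1 / (n : ℝ) *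
        ∑ a, ψ a (e.history p par x₀ r s k o, e.zhat p par x₀ r s k o) ∂P :=
  haveI : MeasurableSingletonClass (Vec d × (Fin k → Fin n × Vec d)) := inferInstance
  SimpleMap.integral_uniform (e.measurable_sample r s k)
    ((e.simpleMap_history p par x₀ r s k).comp₂ (e.simpleMap_zhat p par x₀ r s k) Prod.mk)
    (hu.sample_indep r hr s hs k hk) (hu.sample_uniform r hr s hs k hk) ψ

/-- The sample is independent of `x̃` and `ẑ_k` jointly, so it can be averaged with `ŷ_k` and `ẑ_k -
xs` both frozen. -/
theorem Unbiased.integral_inner_direction (hu : e.Unbiased P p par x₀ R) (hn : 0 < n)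
    (h : p.IsSparseSmoothConvex L) {r s k : ℕ} (hr : r < R) (hs : s < par.S) (hk : k < m)
    (xs : Vec d) :
    ∫ o, inner ℝ (e.direction p par x₀ r s k o) (e.zhat p par x₀ r s k o - xs) ∂P =
      ∫ o, inner ℝ (gradient p.obj (e.yhat p par x₀ r s k o))
        (e.zhat p par x₀ r s k o - xs) ∂P := by
  refine (hu.integral_sample hr hs hk fun a b =>
    inner ℝ (p.estimator b.1.1 a (couple p par b.1.1 b.2)) (b.2 - xs)).trans ?_
  refine integral_congr_ae (.of_forall fun o => ?_)
  exact h.mean_inner_estimator hn _ _ _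

theorem Unbiased.integral_norm_direction_sq (hu : e.Unbiased P p par x₀ R) {r s k : ℕ}
    (hr : r < R) (hs : s < par.S) (hk : k < m) :
    ∫ o, ‖e.direction p par x₀ r s k o‖ ^ 2 ∂P =
      ∫ o, 1 / (n : ℝ) * ∑ a, ‖p.estimator (e.stateAt p par x₀ r s o).snapshot a
        (e.yhat p par x₀ r s k o)‖ ^ 2 ∂P :=
  hu.integral_sample hr hs hk fun a b =>
    ‖p.estimator b.1.1 a (couple p par b.1.1 b.2)‖ ^ 2

/-- For `j < k` the direction of iteration `j` is a function of the history, of which the sample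
`i_k` is independent; hence the gain of `Δ`. -/
theorem Unbiased.integral_norm_proj_sq_le (hu : e.Unbiased P p par x₀ R) {r s k j : ℕ}
    (hr : r < R) (hs : s < par.S) (hk : k < m) (hj : j < k) :
    ∫ o, ‖p.proj (e.sample r s k o) (e.direction p par x₀ r s j o)‖ ^ 2 ∂P ≤
      p.density * ∫ o, ‖e.direction p par x₀ r s j o‖ ^ 2 ∂P := by
  have hd := e.simpleMap_direction p par x₀ r s j
  rw [← integral_const_mul]
  refine (hu.integral_sample hr hs hk fun a b => ‖p.proj a (p.estimator b.1.1 (b.1.2 ⟨j, hj⟩).1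
    (couple p par b.1.1 (b.1.2 ⟨j, hj⟩).2))‖ ^ 2).trans_le ?_
  refine integral_mono (hd.comp fun g => 1 / (n : ℝ) * ∑ a, ‖p.proj a g‖ ^ 2).integrable
    (hd.comp fun g => p.density * ‖g‖ ^ 2).integrable fun o => ?_
  exact p.sum_norm_proj_sq_le _

theorem Unbiased.integral_pick (hu : e.Unbiased P p par x₀ R) {r s : ℕ} (hr : r < R)
    (hs : s < par.S) :
    ∫ o, p.obj (e.stateAt p par x₀ r (s + 1) o).snapshot ∂P =
      1 / (m : ℝ) * ∑ k ∈ Finset.range m, ∫ o, p.obj (e.yhat p par x₀ r s k o) ∂P := by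
  have := SimpleMap.integral_uniform (e.measurable_pick r s)
    (e.simpleMap_history p par x₀ r s m) (hu.pick_indep r hr s hs) (hu.pick_uniform r hr s hs)
    fun t b => p.obj (couple p par b.1 (b.2 t).2)
  rw [← integral_finsetSum _ fun k _ => ((e.simpleMap_yhat p par x₀ r s k).comp p.obj).integrable,
    ← integral_const_mul]
  refine this.trans (integral_congr_ae (.of_forall fun o => ?_))
  exact congrArg (1 / (m : ℝ) * ·)
    (Fin.sum_univ_eq_sum_range (fun k => p.obj (e.yhat p par x₀ r s k o)) m)

end Expectation

end Execution

/-! ### Overlap counting -/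

/-- Each index is the later member of at most `τ` overlapping pairs and the earlier member of at
most `τ`. -/
theorem sum_overlap_le {a : ℕ → ℝ} (ha : ∀ k, 0 ≤ a k) (m τ : ℕ) :
    ∑ k ∈ Finset.range m, ∑ j ∈ (Finset.range k).filter (fun j => k ≤ j + τ), (a j + a k) ≤
      2 * τ * ∑ k ∈ Finset.range m, a k := by
  have h1 : ∑ k ∈ Finset.range m, ∑ j ∈ (Finset.range k).filter (fun j => k ≤ j + τ), a k ≤
      τ * ∑ k ∈ Finset.range m, a k := by
    rw [Finset.mul_sum]
    refine Finset.sum_le_sum fun k _ => ?_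
    rw [Finset.sum_const, nsmul_eq_mul]
    refine mul_le_mul_of_nonneg_right (Nat.cast_le.2 ?_) (ha k)
    calc ((Finset.range k).filter fun j => k ≤ j + τ).card
        ≤ (Finset.Ico (k - τ) k).card := Finset.card_le_card fun j hj => by
          simp only [Finset.mem_filter, Finset.mem_range, Finset.mem_Ico] at hj ⊢
          omega
      _ ≤ τ := by simp; omega
  have h2 : ∑ k ∈ Finset.range m, ∑ j ∈ (Finset.range k).filter (fun j => k ≤ j + τ), a j ≤
      τ * ∑ k ∈ Finset.range m, a k := by
    rw [Finset.sum_comm' (t' := Finset.range m)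
      (s' := fun j => (Finset.range m).filter fun k => j < k ∧ k ≤ j + τ)
      (h := fun k j => by simp only [Finset.mem_filter, Finset.mem_range]; omega),
      Finset.mul_sum]
    refine Finset.sum_le_sum fun j _ => ?_
    rw [Finset.sum_const, nsmul_eq_mul]
    refine mul_le_mul_of_nonneg_right (Nat.cast_le.2 ?_) (ha j)
    calc ((Finset.range m).filter fun k => j < k ∧ k ≤ j + τ).card
        ≤ (Finset.Ioc j (j + τ)).card := Finset.card_le_card fun k hk => by
          simp only [Finset.mem_filter, Finset.mem_range, Finset.mem_Ioc] at hk ⊢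
          omega
      _ = τ := by simp
  simp_rw [Finset.sum_add_distrib]
  linarith

/-- One-step inequality of the coupling, before taking expectations: `η` and `φ` are tuned so that
the second moment of the estimator is absorbed. -/
theorem couple_obj_sub_le {n d : ℕ} {p : Problem n d} {L a : ℝ} (h : p.IsSparseSmoothConvex L)
    (hn : 0 < n) (hL : 0 < L) {par : Params} (hθ : 0 ≤ par.θ) (hη : 0 ≤ par.η) (ha : 0 ≤ a)
    (hφ : par.φ = (1 - par.θ) / L) (hηa : par.θ * par.η * a * L = 1 - par.θ) (xt zh xs : Vec d) :
    p.obj (couple p par xt zh) - p.obj xs ≤ (1 - par.θ) * (p.obj xt - p.obj xs) +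
      par.θ * inner ℝ (gradient p.obj (couple p par xt zh)) (zh - xs) -
      par.θ * par.η * a / 2 *
        (1 / (n : ℝ) * ∑ i, ‖p.estimator xt i (couple p par xt zh)‖ ^ 2) := by
  set y := couple p par xt zh with hy
  set u := p.scaleD (gradient p.obj xt) with hu
  have h1 := h.convexOn_obj.add_inner_gradient_le h.differentiable_obj xs y
  have h2 := h.mean_norm_estimator_sq_le hn hL xt y
  -- The definition of the coupling, solved for the displacement that convexity at `y` is tested
  -- against.
  have h3 : par.θ • (y - xs) = par.θ • (zh - xs) + (1 - par.θ) • (xt - y) - par.φ • u := by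
    rw [hy, couple, ← hu]
    module
  have h4 := congrArg (fun x => inner ℝ (gradient p.obj y) x) h3
  simp only [inner_add_right, inner_sub_right _ _ (par.φ • u), real_inner_smul_right] at h4
  rw [← neg_sub y xs, inner_neg_right] at h1
  -- The factor `θηa/2` equals `φ/2`, so the `D`-term of the second moment meets the shift of the
  -- coupling exactly, and `θηaL = 1 - θ` matches the Bregman term.
  have h5 := mul_le_mul_of_nonneg_left h2 (by positivity : 0 ≤ par.θ * par.η * a / 2)
  have hφ' : par.φ = par.θ * par.η * a := by
    rw [hφ, ← hηa]
    field_simp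
  rw [← hu] at h5
  rw [hφ'] at h4
  have h6 := mul_le_mul_of_nonneg_left h1 hθ
  set B := inner ℝ (gradient p.obj y) (xt - y)
  set q := inner ℝ (gradient p.obj y) u
  have h7 : par.θ * par.η * a / 2 * (2 * L * (p.obj xt - p.obj y - B) + 2 * q) =
      (1 - par.θ) * (p.obj xt - p.obj y - B) + par.θ * par.η * a * q := by
    rw [← hηa]
    ring
  rw [h7] at h5
  linarith

/-! ### Expected progress over an epoch -/

namespace Execution

variable {Ω : Type*} [MeasurableSpace Ω] {n d m : ℕ} {e : Execution Ω n d m} {p : Problem n d}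
  {par : Params} {x₀ : Vec d} {P : Measure Ω} [IsProbabilityMeasure P] {R τ : ℕ} {L a : ℝ}

/-- Split `ẑ_k - xs` at the virtual iterate `z_k`: the first piece is the overlap error, the second
comes from expanding `‖z_{k+1} - xs‖²`. -/
theorem integral_inner_direction_le (h : p.IsSparseSmoothConvex L) (hn : 0 < n)
    (hη : 0 < par.η) (hu : e.Unbiased P p par x₀ R) (hb : e.BoundedOverlap par R τ) {r s k : ℕ}
    (hr : r < R) (hs : s < par.S) (hk : k < m) (xs : Vec d) :
    ∫ o, inner ℝ (e.direction p par x₀ r s k o) (e.zhat p par x₀ r s k o - xs) ∂P ≤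
      par.η * (√p.density / 2) * ∑ j ∈ (Finset.range k).filter (fun j => k ≤ j + τ),
        (∫ o, ‖e.direction p par x₀ r s j o‖ ^ 2 ∂P +
          ∫ o, ‖e.direction p par x₀ r s k o‖ ^ 2 ∂P) +
      1 / (2 * par.η) * (∫ o, ‖e.zvirt p par x₀ r s k o - xs‖ ^ 2 ∂P -
        ∫ o, ‖e.zvirt p par x₀ r s (k + 1) o - xs‖ ^ 2 ∂P) +
      par.η / 2 * ∫ o, ‖e.direction p par x₀ r s k o‖ ^ 2 ∂P := by
  have hG := e.simpleMap_direction p par x₀ r s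
  have hz := e.simpleMap_zvirt p par x₀ r s
  have hsq : ∀ k, Integrable (fun o => ‖e.direction p par x₀ r s k o‖ ^ 2) P :=
    fun k => ((hG k).comp fun g => ‖g‖ ^ 2).integrable
  have hzsq : ∀ k, Integrable (fun o => ‖e.zvirt p par x₀ r s k o - xs‖ ^ 2) P :=
    fun k => ((hz k).comp fun g => ‖g - xs‖ ^ 2).integrable
  have hproj : ∀ j, Integrable (fun o => (2 * √p.density)⁻¹ *
      ‖p.proj (e.sample r s k o) (e.direction p par x₀ r s j o)‖ ^ 2 +
        √p.density / 2 * ‖e.direction p par x₀ r s k o‖ ^ 2) P := fun j =>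
    ((((e.simpleMap_sample r s k).comp₂ (hG j) fun i g => ‖p.proj i g‖ ^ 2).comp _).integrable).add
      ((hsq k).const_mul _)
  have hpt : ∀ o, inner ℝ (e.direction p par x₀ r s k o) (e.zhat p par x₀ r s k o - xs) ≤
      par.η * ∑ j ∈ (Finset.range k).filter (fun j => k ≤ j + τ),
        ((2 * √p.density)⁻¹ *
          ‖p.proj (e.sample r s k o) (e.direction p par x₀ r s j o)‖ ^ 2 +
          √p.density / 2 * ‖e.direction p par x₀ r s k o‖ ^ 2) +
      1 / (2 * par.η) * (‖e.zvirt p par x₀ r s k o - xs‖ ^ 2 -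
        ‖e.zvirt p par x₀ r s (k + 1) o - xs‖ ^ 2) +
      par.η / 2 * ‖e.direction p par x₀ r s k o‖ ^ 2 := by
    intro o
    have h1 := inner_estimator_readZ_sub_virtualZ_le h hn par hη.le
      (e.stateAt p par x₀ r s o).snapshot (e.stateAt p par x₀ r s o).memory
      (fun j => e.sample r s j o) (fun k' j v => e.written r s k' j v o) (k := k) (τ := τ)
      fun j hj v => hb r hr s hs k hk j hj v o
    change inner ℝ (e.direction p par x₀ r s k o) (e.zhat p par x₀ r s k o -
      e.zvirt p par x₀ r s k o) ≤ par.η * ∑ j ∈ (Finset.range k).filter (fun j => k ≤ j + τ),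
        ((2 * √p.density)⁻¹ *
          ‖p.proj (e.sample r s k o) (e.direction p par x₀ r s j o)‖ ^ 2 +
          √p.density / 2 * ‖e.direction p par x₀ r s k o‖ ^ 2) at h1
    rw [zvirt_succ]
    set G := e.direction p par x₀ r s k o
    set z := e.zvirt p par x₀ r s k o
    have h2 : inner ℝ G (e.zhat p par x₀ r s k o - xs) =
        inner ℝ G (e.zhat p par x₀ r s k o - z) + inner ℝ G (z - xs) := by
      rw [← inner_add_right, sub_add_sub_cancel]
    have h3 : 1 / (2 * par.η) * (‖z - xs‖ ^ 2 - ‖z - par.η • G - xs‖ ^ 2) =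
        inner ℝ G (z - xs) - par.η / 2 * ‖G‖ ^ 2 := by
      rw [sub_right_comm, norm_sub_sq_real (z - xs), norm_smul, real_inner_smul_right, real_inner_comm,
        mul_pow, Real.norm_eq_abs, sq_abs]
      field_simp
      ring
    rw [h2, h3]
    linarith
  have hi1 : Integrable (fun o => ∑ j ∈ (Finset.range k).filter (fun j => k ≤ j + τ),
      ((2 * √p.density)⁻¹ *
        ‖p.proj (e.sample r s k o) (e.direction p par x₀ r s j o)‖ ^ 2 +
        √p.density / 2 * ‖e.direction p par x₀ r s k o‖ ^ 2)) P :=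
    integrable_finsetSum _ fun j _ => hproj j
  have hi2 : Integrable (fun o => ‖e.zvirt p par x₀ r s k o - xs‖ ^ 2 -
      ‖e.zvirt p par x₀ r s (k + 1) o - xs‖ ^ 2) P := (hzsq k).sub (hzsq (k + 1))
  refine (integral_mono (((hG k).comp₂ (e.simpleMap_zhat p par x₀ r s k)
    fun g z => inner ℝ g (z - xs)).integrable)
    (((hi1.const_mul _).add (hi2.const_mul _)).add ((hsq k).const_mul _)) hpt).trans ?_
  rw [integral_add' ((hi1.const_mul _).add (hi2.const_mul _)) ((hsq k).const_mul _),
    integral_add' (hi1.const_mul _) (hi2.const_mul _), integral_const_mul, integral_const_mul,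
    integral_const_mul, integral_sub (hzsq k) (hzsq (k + 1)),
    integral_finsetSum _ fun j _ => hproj j, mul_assoc]
  gcongr ?_ + _ + _
  refine mul_le_mul_of_nonneg_left ?_ hη.le
  rw [Finset.mul_sum]
  refine Finset.sum_le_sum fun j hj => ?_
  have hj' : j < k := by simpa using (Finset.mem_filter.1 hj).1
  rw [integral_add (((e.simpleMap_sample r s k).comp₂ (hG j) fun i g =>
    ‖p.proj i g‖ ^ 2).comp _).integrable ((hsq k).const_mul _), integral_const_mul,
    integral_const_mul, mul_add]
  gcongr ?_ + _
  have h1 := mul_le_mul_of_nonneg_left (hu.integral_norm_proj_sq_le hr hs hk hj')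
    (by positivity : 0 ≤ (2 * √p.density)⁻¹)
  refine h1.trans_eq ?_
  -- If `Δ = 0`, the coefficient `(2√Δ)⁻¹` is zero by convention.
  rcases (Real.sqrt_nonneg p.density).eq_or_lt with h0 | h0
  · simp [← h0]
  · nth_rewrite 2 [← Real.mul_self_sqrt p.density_nonneg]
    field_simp

/-- The expected progress of an epoch. -/
theorem epoch_progress (h : p.IsSparseSmoothConvex L) (hn : 0 < n) (hL : 0 < L) (hm : 0 < m)
    (hθ : 0 ≤ par.θ) (hη : 0 < par.η) (ha : 1 + 2 * √p.density * τ ≤ a)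
    (hφ : par.φ = (1 - par.θ) / L) (hηa : par.θ * par.η * a * L = 1 - par.θ)
    (hu : e.Unbiased P p par x₀ R) (hb : e.BoundedOverlap par R τ) {r s : ℕ}
    (hr : r < R) (hs : s < par.S) (xs : Vec d) :
    ∫ o, (p.obj (e.stateAt p par x₀ r (s + 1) o).snapshot - p.obj xs) ∂P ≤
      (1 - par.θ) * ∫ o, (p.obj (e.stateAt p par x₀ r s o).snapshot - p.obj xs) ∂P +
      par.θ / (2 * par.η * m) * (∫ o, ‖(e.stateAt p par x₀ r s o).memory - xs‖ ^ 2 ∂P -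
        ∫ o, ‖(e.stateAt p par x₀ r (s + 1) o).memory - xs‖ ^ 2 ∂P) := by
  have ha0 : 0 ≤ a := le_trans (by positivity) ha
  have hm' : (0 : ℝ) < m := Nat.cast_pos.2 hm
  have hx := e.simpleMap_snapshot p par x₀ r s
  have hzh := e.simpleMap_zhat p par x₀ r s
  have hy := e.simpleMap_yhat p par x₀ r s
  set g : ℕ → ℝ := fun k => ∫ o, ‖e.direction p par x₀ r s k o‖ ^ 2 ∂P with hg
  set Z : ℕ → ℝ := fun k => ∫ o, ‖e.zvirt p par x₀ r s k o - xs‖ ^ 2 ∂P with hZ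
  set F := ∫ o, (p.obj (e.stateAt p par x₀ r s o).snapshot - p.obj xs) ∂P with hF
  have hg0 : ∀ k, 0 ≤ g k := fun k => integral_nonneg fun o => sq_nonneg _
  have hstep : ∀ k ∈ Finset.range m, ∫ o, p.obj (e.yhat p par x₀ r s k o) ∂P - p.obj xs ≤
      (1 - par.θ) * F + par.θ * (par.η * (√p.density / 2) *
        ∑ j ∈ (Finset.range k).filter (fun j => k ≤ j + τ), (g j + g k) +
        1 / (2 * par.η) * (Z k - Z (k + 1)) + par.η / 2 * g k) - par.θ * par.η * a / 2 * g k := by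
    intro k hk
    rw [Finset.mem_range] at hk
    have h1 := integral_inner_direction_le h hn hη hu hb hr hs hk xs
    rw [hu.integral_inner_direction hn h hr hs hk] at h1
    have hi1 : Integrable (fun o => (1 - par.θ) *
        (p.obj (e.stateAt p par x₀ r s o).snapshot - p.obj xs)) P :=
      (hx.comp fun x => (1 - par.θ) * (p.obj x - p.obj xs)).integrable
    have hi2 : Integrable (fun o => par.θ * inner ℝ (gradient p.obj (e.yhat p par x₀ r s k o))
        (e.zhat p par x₀ r s k o - xs)) P :=
      ((hy k).comp₂ (hzh k) fun y z => par.θ * inner ℝ (gradient p.obj y) (z - xs)).integrable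
    have hi3 : Integrable (fun o => par.θ * par.η * a / 2 * (1 / (n : ℝ) * ∑ i,
        ‖p.estimator (e.stateAt p par x₀ r s o).snapshot i (e.yhat p par x₀ r s k o)‖ ^ 2)) P :=
      (hx.comp₂ (hy k) fun x y => par.θ * par.η * a / 2 * (1 / (n : ℝ) * ∑ i,
        ‖p.estimator x i y‖ ^ 2)).integrable
    have h2 := integral_mono (μ := P) ((hy k).comp fun y => p.obj y - p.obj xs).integrable
      ((hi1.add hi2).sub hi3) fun o =>
        couple_obj_sub_le h hn hL hθ hη.le ha0 hφ hηa (e.stateAt p par x₀ r s o).snapshot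
          (e.zhat p par x₀ r s k o) xs
    rw [integral_sub' (hi1.add hi2) hi3, integral_add' hi1 hi2, integral_const_mul,
      integral_const_mul, integral_const_mul, ← hu.integral_norm_direction_sq hr hs hk,
      integral_sub ((hy k).comp p.obj).integrable (integrable_const _), integral_const,
      probReal_univ, one_smul] at h2
    have h3 := mul_le_mul_of_nonneg_left h1 hθ
    simp only [hg, hZ, hF]
    linarith
  have hsum := Finset.sum_le_sum hstep
  have hov := sum_overlap_le hg0 m τ
  have htel := Finset.sum_range_sub' Z m
  simp only [Finset.sum_sub_distrib, Finset.sum_add_distrib, ← Finset.mul_sum, Finset.sum_const,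
    Finset.card_range, nsmul_eq_mul] at hsum hov htel
  rw [htel] at hsum
  set SG := ∑ k ∈ Finset.range m, g k
  have hSG : 0 ≤ SG := Finset.sum_nonneg fun k _ => hg0 k
  -- The second moments have total coefficient at most `θη(1 + 2√Δ τ)/2 - θηa/2 ≤ 0` and disappear.
  have hmain : ∑ k ∈ Finset.range m, ∫ o, p.obj (e.yhat p par x₀ r s k o) ∂P - m * p.obj xs ≤
      m * ((1 - par.θ) * F) + par.θ * (1 / (2 * par.η) * (Z 0 - Z m)) := by
    have h1 := mul_le_mul_of_nonneg_left hov
      (by positivity : 0 ≤ par.θ * (par.η * (√p.density / 2)))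
    have h2 := mul_le_mul_of_nonneg_left (mul_le_mul_of_nonneg_right ha hSG)
      (by positivity : 0 ≤ par.θ * par.η / 2)
    linarith
  rw [integral_sub ((e.simpleMap_snapshot p par x₀ r (s + 1)).comp p.obj).integrable
    (integrable_const _), integral_const, probReal_univ, one_smul, hu.integral_pick hr hs]
  -- The virtual iterates `z_0` and `z_m` are the memory contents at the two ends of the epoch.
  change _ ≤ (1 - par.θ) * F + par.θ / (2 * par.η * m) * (Z 0 - Z m)
  have := mul_le_mul_of_nonneg_left hmain (by positivity : 0 ≤ 1 / (m : ℝ))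
  calc _ = 1 / (m : ℝ) * (∑ k ∈ Finset.range m, ∫ o, p.obj (e.yhat p par x₀ r s k o) ∂P -
        m * p.obj xs) := by field_simp
    _ ≤ _ := this
    _ = _ := by field_simp

end Execution

/-! ### The parameters -/

namespace Params

variable {L κ a ω : ℝ} {m : ℕ}

theorem choice_S_le (hω : 0 ≤ ω) :
    ((choice L κ a ω m).S : ℝ) ≤ 2 * ω * √(κ / m * a) + 1 :=
  (Nat.ceil_lt_add_one (by positivity)).le

theorem one_sub_choice_θ (hm : 0 < m) :
    1 - (choice L κ a ω m).θ = √(κ * a) / (√(κ * a) + √m) := by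
  have : 0 < √(m : ℝ) := Real.sqrt_pos.2 (Nat.cast_pos.2 hm)
  have : 0 < √(κ * a) + √m := by positivity
  simp only [choice]
  field_simp
  ring

theorem choice_θ_pos (hm : 0 < m) : 0 < (choice L κ a ω m).θ := by
  have : 0 < √(m : ℝ) := Real.sqrt_pos.2 (Nat.cast_pos.2 hm)
  simp only [choice]
  positivity

theorem choice_θ_lt_one (hm : 0 < m) (hκ : 0 < κ * a) : (choice L κ a ω m).θ < 1 := by
  have h : 0 < 1 - (choice L κ a ω m).θ := by
    rw [one_sub_choice_θ hm]
    have := Real.sqrt_pos.2 hκ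
    positivity
  linarith

theorem choice_φ : (choice L κ a ω m).φ = (1 - (choice L κ a ω m).θ) / L := rfl

theorem choice_η : (choice L κ a ω m).η =
    (1 - (choice L κ a ω m).θ) / (L * (choice L κ a ω m).θ * a) := rfl

theorem choice_S_pos (hω : 0 < ω) (hm : 0 < m) (hκ : 0 < κ) (ha : 0 < a) :
    0 < (choice L κ a ω m).S := by
  have : (0 : ℝ) < m := Nat.cast_pos.2 hm
  exact Nat.ceil_pos.2 (by positivity)

/-- The parameters make the contraction factor of a round at most `1 / ω`. -/
theorem choice_contraction {μ : ℝ} (hω : 0 < ω) (hm : 0 < m) (hL : 0 < L) (hμ : 0 < μ)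
    (ha : 0 < a) : let par := choice L (L / μ) a ω m
    1 - par.θ + 2 * (par.θ / (2 * par.η * m)) / μ ≤ par.θ * par.S / ω := by
  intro par
  have hm' : (0 : ℝ) < m := Nat.cast_pos.2 hm
  have hκ : 0 < L / μ * a := by positivity
  have hθ : 0 < par.θ := choice_θ_pos hm
  have hθ1 : 1 - par.θ = √(L / μ * a) / (√(L / μ * a) + √m) := one_sub_choice_θ hm
  have hθe : par.θ = √m / (√(L / μ * a) + √m) := rfl
  have hη : par.η = (1 - par.θ) / (L * par.θ * a) := rfl
  have hS : 2 * ω * (√(L / μ * a) / √m) ≤ par.S := by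
    rw [← Real.sqrt_div hκ.le, ← div_mul_eq_mul_div]
    exact Nat.le_ceil _
  set q := √(L / μ * a) with hq
  set w := √(m : ℝ) with hw
  have hq0 : 0 < q := Real.sqrt_pos.2 hκ
  have hw0 : 0 < w := Real.sqrt_pos.2 hm'
  have hqq : q ^ 2 = L / μ * a := Real.sq_sqrt hκ.le
  have hww : w ^ 2 = m := Real.sq_sqrt hm'.le
  -- The choice of `θ` balances the distance term against `1 - θ`: both equal `q / (q + w)`. Their
  -- sum over `θ` is `2q / w`, hence the factor 2 in `S`.
  have h1 : 2 * (par.θ / (2 * par.η * m)) / μ = q / (q + w) := by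
    have : 2 * (par.θ / (2 * par.η * m)) / μ =
        par.θ ^ 2 * (L / μ * a) / ((1 - par.θ) * m) := by
      have : 0 < 1 - par.θ := by rw [hθ1]; positivity
      rw [hη]
      field_simp
    rw [this, ← hqq, ← hww, hθ1, hθe]
    field_simp
  rw [h1, hθ1, le_div_iff₀ hω]
  calc (q / (q + w) + q / (q + w)) * ω = par.θ * (2 * ω * (q / w)) := by
        rw [hθe]
        field_simp
        ring
    _ ≤ par.θ * par.S := by gcongr

/-- The gradient evaluations of a round. -/
theorem choice_calls_le {c₁ c₂ : ℝ} {n : ℕ} (hω : 0 < ω) (hc₁ : 0 < c₁) (hn : 0 < n)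
    (hm₁ : c₁ * n ≤ m) (hm₂ : (m : ℝ) ≤ c₂ * n) (hκ : 0 ≤ κ) (ha : 0 ≤ a) :
    ((choice L κ a ω m).S : ℝ) * (n + 2 * m) ≤
      (1 + 2 * |c₂|) * (2 * ω / √c₁ + 1) * max (n : ℝ) (√(κ * n * a)) := by
  have hn' : (0 : ℝ) < n := Nat.cast_pos.2 hn
  have hc : 0 < √c₁ := Real.sqrt_pos.2 hc₁
  set M := max (n : ℝ) (√(κ * n * a)) with hM
  -- The lower bound on `m` limits the number of epochs; the upper bound is needed only for the cost
  -- of each epoch.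
  have h1 : √(κ / m * a) ≤ √(κ * n * a) / (√c₁ * n) := by
    rw [← Real.sqrt_sq hn'.le, ← Real.sqrt_mul hc₁.le, Real.sqrt_sq hn'.le,
      ← Real.sqrt_div (by positivity)]
    refine Real.sqrt_le_sqrt ?_
    calc κ / m * a ≤ κ / (c₁ * n) * a := by gcongr
      _ = κ * n * a / (c₁ * n ^ 2) := by field_simp
  have h2 : ((choice L κ a ω m).S : ℝ) * n ≤ (2 * ω / √c₁ + 1) * M := by
    calc ((choice L κ a ω m).S : ℝ) * n
        ≤ (2 * ω * (√(κ * n * a) / (√c₁ * n)) + 1) * n := by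
          gcongr
          exact (choice_S_le hω.le).trans (by gcongr)
      _ = 2 * ω / √c₁ * √(κ * n * a) + n := by field_simp
      _ ≤ 2 * ω / √c₁ * M + M := by
          gcongr
          · exact le_max_right _ _
          · exact le_max_left _ _
      _ = _ := by ring
  calc ((choice L κ a ω m).S : ℝ) * (n + 2 * m)
      ≤ (choice L κ a ω m).S * (n + 2 * (|c₂| * n)) := by
        gcongr
        exact hm₂.trans (by gcongr; exact le_abs_self c₂)
    _ = (1 + 2 * |c₂|) * ((choice L κ a ω m).S * n) := by ring
    _ ≤ (1 + 2 * |c₂|) * ((2 * ω / √c₁ + 1) * M) := by gcongr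
    _ = _ := by ring

end Params

/-! ### Cost of the rounds and contraction over a round -/

namespace Execution

variable {Ω : Type*} [MeasurableSpace Ω] {n d m : ℕ} {e : Execution Ω n d m} {p : Problem n d}
  {par : Params} {x₀ : Vec d} {P : Measure Ω} [IsProbabilityMeasure P] {R τ : ℕ} {L a μ : ℝ}

theorem calls_epochs (o : Ω) (r : ℕ) (x : Vec d) (c s : ℕ) :
    (e.epochs p par o r x c s).calls = c + s * (n + 2 * m) := by
  induction s with
  | zero => simp [epochs]
  | succ s ih =>
    simp only [epochs, ih]
    ring

theorem oracleCalls_eq (o : Ω) (R : ℕ) :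
    e.oracleCalls p par x₀ R o = R * (par.S * (n + 2 * m)) := by
  induction R with
  | zero => simp [oracleCalls, rounds]
  | succ R ih =>
    rw [oracleCalls] at ih ⊢
    simp only [rounds, calls_epochs, ih]
    ring

theorem output_succ (r : ℕ) (o : Ω) : e.output p par x₀ (r + 1) o =
    (1 / (par.S : ℝ)) •
      ∑ s ∈ Finset.range par.S, (e.stateAt p par x₀ r (s + 1) o).snapshot := rfl

theorem integrable_obj_output (e : Execution Ω n d m) (p : Problem n d) (par : Params)
    (x₀ : Vec d) (r : ℕ) : Integrable (fun o => p.obj (e.output p par x₀ r o)) P :=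
  ((e.simpleMap_rounds p par x₀ r).comp p.obj).integrable

theorem obj_output_succ_le (h : p.IsSparseSmoothConvex L) (hS : 0 < par.S) (r : ℕ) (o : Ω) :
    p.obj (e.output p par x₀ (r + 1) o) ≤ 1 / (par.S : ℝ) *
      ∑ s ∈ Finset.range par.S, p.obj (e.stateAt p par x₀ r (s + 1) o).snapshot := by
  have hS' : (par.S : ℝ) ≠ 0 := Nat.cast_ne_zero.2 hS.ne'
  rw [output_succ, Finset.smul_sum, Finset.mul_sum]
  exact h.convexOn_obj.map_sum_le (fun _ _ => by positivity) (by simp [hS'])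
    fun _ _ => Set.mem_univ _

/-- Summing the epochs, each inner `F s` cancels up to a share `θ`, and the distances telescope
because the memory is carried from epoch to epoch. -/
theorem sum_progress_le {θ c : ℝ} {F Z : ℕ → ℝ} {S : ℕ}
    (hstep : ∀ s < S, F (s + 1) ≤ (1 - θ) * F s + c * (Z s - Z (s + 1))) :
    θ * ∑ s ∈ Finset.range S, F (s + 1) + (1 - θ) * F S + c * Z S ≤
      (1 - θ) * F 0 + c * Z 0 := by
  induction S with
  | zero => simp
  | succ S ih =>
    rw [Finset.sum_range_succ]
    linarith [ih fun s hs => hstep s (by omega), hstep S (by omega)]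

/-- A round contracts the expected suboptimality. -/
theorem round_contraction (h : p.IsSparseSmoothConvex L) {xs : Vec d}
    (hq : p.QuadraticGrowth μ xs) (hn : 0 < n) (hL : 0 < L) (hμ : 0 < μ) (hm : 0 < m)
    (hθ : 0 < par.θ) (hθ1 : par.θ < 1) (hη : 0 < par.η) (hS : 0 < par.S)
    (ha : 1 + 2 * √p.density * τ ≤ a)
    (hφ : par.φ = (1 - par.θ) / L) (hηa : par.θ * par.η * a * L = 1 - par.θ) {ω : ℝ}
    (hω : 1 - par.θ + 2 * (par.θ / (2 * par.η * m)) / μ ≤ par.θ * par.S / ω)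
    (hu : e.Unbiased P p par x₀ R) (hb : e.BoundedOverlap par R τ) {r : ℕ} (hr : r < R) :
    ∫ o, (p.obj (e.output p par x₀ (r + 1) o) - p.obj xs) ∂P ≤
      1 / ω * ∫ o, (p.obj (e.output p par x₀ r o) - p.obj xs) ∂P := by
  have hm' : (0 : ℝ) < m := Nat.cast_pos.2 hm
  have hS' : (0 : ℝ) < par.S := Nat.cast_pos.2 hS
  have hgap : ∀ x, 0 ≤ p.obj x - p.obj xs := fun x => le_trans (by positivity) (hq x)
  have hx := e.simpleMap_snapshot p par x₀ r
  set F : ℕ → ℝ := fun s =>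
    ∫ o, (p.obj (e.stateAt p par x₀ r s o).snapshot - p.obj xs) ∂P with hF
  set Z : ℕ → ℝ := fun s => ∫ o, ‖(e.stateAt p par x₀ r s o).memory - xs‖ ^ 2 ∂P with hZ
  have hF0 : ∀ s, 0 ≤ F s := fun s => integral_nonneg fun o => hgap _
  have hZ0 : ∀ s, 0 ≤ Z s := fun s => integral_nonneg fun o => sq_nonneg _
  have hFi : ∀ s, Integrable
      (fun o => p.obj (e.stateAt p par x₀ r s o).snapshot - p.obj xs) P :=
    fun s => ((hx s).comp fun x => p.obj x - p.obj xs).integrable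
  -- A restart resets the memory to the snapshot, so quadratic growth turns the initial distance
  -- into the initial gap.
  have hZF : Z 0 ≤ 2 / μ * F 0 := by
    rw [hZ, hF, ← integral_const_mul]
    refine integral_mono ((e.simpleMap_memory p par x₀ r 0).comp fun x =>
      ‖x - xs‖ ^ 2).integrable ((hFi 0).const_mul _) fun o => ?_
    change ‖(e.stateAt p par x₀ r 0 o).snapshot - xs‖ ^ 2 ≤ _
    have := mul_le_mul_of_nonneg_left (hq (e.stateAt p par x₀ r 0 o).snapshot)
      (by positivity : 0 ≤ 2 / μ)
    refine le_trans (le_of_eq ?_) this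
    field_simp
  have hsum := sum_progress_le (F := F) (Z := Z) fun s hs =>
    epoch_progress h hn hL hm hθ.le hη ha hφ hηa hu hb hr hs xs
  have hc : 0 ≤ par.θ / (2 * par.η * m) := by positivity
  have h1 : par.θ * ∑ s ∈ Finset.range par.S, F (s + 1) ≤ par.θ * par.S / ω * F 0 := by
    have h2 := mul_nonneg (sub_nonneg.2 hθ1.le) (hF0 par.S)
    have h3 := mul_nonneg hc (hZ0 par.S)
    have h4 := mul_le_mul_of_nonneg_left hZF hc
    have h5 := mul_le_mul_of_nonneg_right hω (hF0 0)
    have h6 : par.θ / (2 * par.η * m) * (2 / μ * F 0) =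
        2 * (par.θ / (2 * par.η * m)) / μ * F 0 := by ring
    linarith
  have h2 : ∑ s ∈ Finset.range par.S, F (s + 1) ≤ par.S / ω * F 0 := by
    refine le_of_mul_le_mul_left (h1.trans_eq ?_) hθ
    ring
  calc ∫ o, (p.obj (e.output p par x₀ (r + 1) o) - p.obj xs) ∂P
      ≤ ∫ o, 1 / (par.S : ℝ) * ∑ s ∈ Finset.range par.S,
          (p.obj (e.stateAt p par x₀ r (s + 1) o).snapshot - p.obj xs) ∂P := by
        refine integral_mono ((e.integrable_obj_output p par x₀ (r + 1)).sub
          (integrable_const _)) ((integrable_finsetSum _ fun s _ => hFi (s + 1)).const_mul _)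
          fun o => ?_
        have := obj_output_succ_le (e := e) (x₀ := x₀) h hS r o
        simp only [Finset.sum_sub_distrib, Finset.sum_const, Finset.card_range, nsmul_eq_mul,
          mul_sub]
        rw [one_div, inv_mul_cancel_left₀ hS'.ne', ← one_div]
        linarith
    _ = 1 / (par.S : ℝ) * ∑ s ∈ Finset.range par.S, F (s + 1) := by
        rw [integral_const_mul, integral_finsetSum _ fun s _ => hFi (s + 1)]
    _ ≤ 1 / (par.S : ℝ) * (par.S / ω * F 0) := by gcongr
    _ = 1 / ω * F 0 := by field_simp

end Execution

end AsyncSVRG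

end

/-! ### Number of rounds and total complexity -/

theorem theorem2 (ω c₁ c₂ : ℝ) (hω : 1 < ω) (hc₁ : 0 < c₁) :
    ∃ C : ℝ, 0 < C ∧
      ∀ (n d m τ : ℕ) (τt L μ : ℝ) (p : AsyncSVRG.Problem n d) (x₀ xs : AsyncSVRG.Vec d) (ε : ℝ),
        0 < n → c₁ * n ≤ m → (m : ℝ) ≤ c₂ * n → (τ : ℝ) ≤ τt → 0 < L → 0 < μ → 0 < ε →
        p.IsSparseSmoothConvex L → p.QuadraticGrowth μ xs →
        ∃ R : ℕ,
          (R : ℝ) ≤ C * max 1 (Real.log ((p.obj x₀ - p.obj xs) / ε)) ∧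
          ∀ (Ω : Type*) [MeasurableSpace Ω] (P : Measure Ω) [IsProbabilityMeasure P]
            (e : AsyncSVRG.Execution Ω n d m) (par : AsyncSVRG.Params),
            par = AsyncSVRG.Params.choice L (L / μ) (1 + 2 * √p.density * τt) ω m →
            e.Unbiased P p par x₀ R → e.BoundedOverlap par R τ →
            Integrable (fun o => p.obj (e.output p par x₀ R o)) P ∧
            (∫ o, p.obj (e.output p par x₀ R o) ∂P) - p.obj xs ≤ ε ∧
            ∀ o, (e.oracleCalls p par x₀ R o : ℝ) ≤
              C * max (n : ℝ) (√(L / μ * n * (1 + 2 * √p.density * τt))) *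
                max 1 (Real.log ((p.obj x₀ - p.obj xs) / ε)) := by
  have hlog : 0 < Real.log ω := Real.log_pos hω
  have hω0 : 0 < ω := one_pos.trans hω
  -- `A` accounts for the rounds and `B` for the gradients per round. The absolute value in `B`
  -- keeps the constant positive without a sign assumption on `c₂`.
  set A := 1 / Real.log ω + 1 with hA
  set B := (1 + 2 * |c₂|) * (2 * ω / √c₁ + 1) with hB
  have hA0 : 0 < A := by positivity
  have hB1 : 1 ≤ B := by
    have h1 : 1 ≤ 1 + 2 * |c₂| := by linarith [abs_nonneg c₂]
    have h2 : 1 ≤ 2 * ω / √c₁ + 1 := by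
      have : 0 ≤ 2 * ω / √c₁ := by positivity
      linarith
    exact one_le_mul_of_one_le_of_one_le h1 h2
  refine ⟨A * B, by positivity, ?_⟩
  intro n d m τ τt L μ p x₀ xs ε hn hm₁ hm₂ hτ hL hμ hε h hq
  set l := Real.log ((p.obj x₀ - p.obj xs) / ε) with hl
  have hm : 0 < m := by
    have : (0 : ℝ) < n := Nat.cast_pos.2 hn
    exact Nat.cast_pos.1 ((by positivity : 0 < c₁ * n).trans_le hm₁)
  have hτt : 0 ≤ τt := (Nat.cast_nonneg τ).trans hτ
  have ha : 0 < 1 + 2 * √p.density * τt := by positivity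
  have hmax : 1 ≤ max 1 l := le_max_left _ _
  -- The number of rounds is the least natural number `R` with `R log ω ≥ l`; the maximum with 1
  -- pays for rounding up.
  have hR : (⌈l / Real.log ω⌉₊ : ℝ) ≤ A * max 1 l := by
    have h1 : l / Real.log ω ≤ max 1 l / Real.log ω := by
      gcongr
      exact le_max_right _ _
    calc (⌈l / Real.log ω⌉₊ : ℝ) ≤ ⌈max 1 l / Real.log ω⌉₊ := by
          exact_mod_cast Nat.ceil_mono h1
      _ ≤ max 1 l / Real.log ω + 1 := (Nat.ceil_lt_add_one (by positivity)).le
      _ ≤ max 1 l / Real.log ω + max 1 l := by gcongr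
      _ = A * max 1 l := by rw [hA]; ring
  refine ⟨⌈l / Real.log ω⌉₊, hR.trans ?_, ?_⟩
  · rw [mul_right_comm]
    exact le_mul_of_one_le_right (by positivity) hB1
  intro Ω _ P _ e par hpar hu hb
  set R := ⌈l / Real.log ω⌉₊
  refine ⟨e.integrable_obj_output p par x₀ R, ?_, fun o => ?_⟩
  · have hθ : 0 < par.θ := hpar ▸ AsyncSVRG.Params.choice_θ_pos hm
    have hθ1 : par.θ < 1 := hpar ▸ AsyncSVRG.Params.choice_θ_lt_one hm (by positivity)
    have hη : par.η = (1 - par.θ) / (L * par.θ * (1 + 2 * √p.density * τt)) :=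
      hpar ▸ AsyncSVRG.Params.choice_η
    have hS : 0 < par.S :=
      hpar ▸ AsyncSVRG.Params.choice_S_pos hω0 hm (by positivity) ha
    have hcontr := hpar ▸ AsyncSVRG.Params.choice_contraction hω0 hm hL hμ ha
    have h1 : 0 < 1 - par.θ := sub_pos.2 hθ1
    have hrounds : ∀ r ≤ R, ∫ o, (p.obj (e.output p par x₀ r o) - p.obj xs) ∂P ≤
        (1 / ω) ^ r * (p.obj x₀ - p.obj xs) := by
      intro r
      induction r with
      | zero =>
        intro _
        simp [AsyncSVRG.Execution.output, AsyncSVRG.Execution.rounds]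
      | succ r ih =>
        intro hr
        have := AsyncSVRG.Execution.round_contraction (a := 1 + 2 * √p.density * τt)
          h hq hn hL hμ hm hθ hθ1
          (hη ▸ by positivity) hS (by gcongr) (hpar ▸ AsyncSVRG.Params.choice_φ)
          (by rw [hη]; field_simp) hcontr hu hb hr
        refine this.trans ?_
        rw [pow_succ', mul_assoc]
        exact mul_le_mul_of_nonneg_left (ih (by omega)) (by positivity)
    have hfin := hrounds R le_rfl
    rw [integral_sub (e.integrable_obj_output p par x₀ R) (integrable_const _), integral_const,
      probReal_univ, one_smul] at hfin
    refine hfin.trans ?_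
    rw [one_div, inv_pow, inv_mul_le_iff₀ (by positivity), ← div_le_iff₀ hε]
    -- The logarithm controls the ratio only when it is positive; otherwise `ω ^ R > 0` is enough.
    rcases le_or_gt ((p.obj x₀ - p.obj xs) / ε) 0 with h0 | h0
    · exact h0.trans (by positivity)
    · rw [← Real.log_le_log_iff h0 (by positivity), Real.log_pow, ← div_le_iff₀ hlog]
      exact Nat.le_ceil _
  · rw [AsyncSVRG.Execution.oracleCalls_eq]
    push_cast
    calc (R : ℝ) * (par.S * (n + 2 * m))
        ≤ A * max 1 l * (B * max (n : ℝ) (√(L / μ * n * (1 + 2 * √p.density * τt)))) := by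
          refine mul_le_mul hR ?_ (by positivity) (by positivity)
          rw [hpar]
          exact AsyncSVRG.Params.choice_calls_le hω0 hc₁ hn hm₁ hm₂ (by positivity) ha.le
      _ = _ := by ring
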